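/- Let $p=\frac{\ln 2}{2\pi}$. Let $S_0=\{|\arg\zeta|<\frac{\pi}{4}\}$, $S_1=\{\frac{\pi}{4}<\arg\zeta<\frac{3\pi}{4}\}$, $S_{-1}=\{-\frac{3\pi}{4}<\arg\zeta<-\frac{\pi}{4}\}$, $S_2=\{\frac{3\pi}{4}<\arg\zeta<\pi\}$, $S_{-2}=\{-\pi<\arg\zeta<-\frac{3\pi}{4}\}$ (with $\zeta\neq 0$), and let $\Sigma$ be the complement of the union of these five sectors, i.e. the origin together with the five rays $\arg\zeta=\pm\frac{\pi}{4},\pm\frac{3\pi}{4},\pi$. Consider the Riemann–Hilbert problem of finding a $3\times 3$ matrix function $\mathbf U(\zeta)$ on $\mathbb{C}\setminus\Sigma$ such that: 1. $\mathbf U$ is analytic in each of the five sectors and extends continuously to the closure of each sector; 2. if $\mathbf U^{(k)}$ denotes the boundary value taken from $S_k$, then $$\mathbf U^{(0)}=\mathbf U^{(1)}\begin{bmatrix}1&0&0\\-e^{i\zeta^2}&1&0\\0&0&1\end{bmatrix}\ \left(\arg\zeta=\tfrac{\pi}{4}\right),\qquad \mathbf U^{(1)}=\mathbf U^{(2)}\begin{bmatrix}1&\frac12e^{-i\zeta^2}&0\\0&1&0\\0&0&1\end{bmatrix}\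 \left(\arg\zeta=\tfrac{3\pi}{4}\right),$$ $$\mathbf U^{(2)}=\mathbf U^{(-2)}\,\mathrm{diag}\left(2,\tfrac12,1\right)\ \left(\arg\zeta=\pi\right),$$ $$\mathbf U^{(-1)}=\mathbf U^{(-2)}\begin{bmatrix}1&0&0\\-\frac12e^{i\zeta^2}&1&0\\0&0&1\end{bmatrix}\ \left(\arg\zeta=-\tfrac{3\pi}{4}\right),\qquad \mathbf U^{(0)}=\mathbf U^{(-1)}\begin{bmatrix}1&e^{-i\zeta^2}&0\\0&1&0\\0&0&1\end{bmatrix}\ \left(\arg\zeta=-\tfrac{\pi}{4}\right);$$ 3. $\mathbf U(\zeta)\,\mathrm{diag}(\zeta^{ip},\zeta^{-ip},1)\to\mathbb{I}$ as $\zeta\to\infty$, $\zeta\notin\Sigma$, with principal branches of the powers. This problem has exactly one solution $\mathbf U$ on $\mathbb C\setminus\Sigma$. There are complex constants $r,s$ such that, as $\zeta\to\infty$ with $\zeta\notin\Sigma$, uniformly in the direction, $$\mathbf U(\zeta)\,\mathrm{diag}(\zeta^{ip},\zeta^{-ip},1)=\mathbb{I}+\frac{1}{2i\zeta}\begin{bmatrix}0&r&0\\-s&0&0\\0&0&0\end{bmatrix}+O(\zeta^{-2}),$$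 and any constants $r,s$ with this property satisfy $$r=-s^*=\frac{2^{5/4}\,e^{\frac{i(\ln 2)^2}{2\pi}}\sqrt{\pi}\,e^{\frac{i\pi}{4}}}{\Gamma\left(\frac{i\ln 2}{2\pi}\right)},$$ where $^*$ denotes complex conjugation. In particular $|r|=\sqrt{\frac{\ln 2}{\pi}}$. -/

import Mathlib

noncomputable section

/-- The constant `p = ln 2 / (2 π)`. -/
def pcP : ℝ := Real.log 2 / (2 * Real.pi)

/-- The open sector `α < arg ζ < β` with vertex `0` (principal argument). -/
def pcSector (α β : ℝ) : Set ℂ := {ζ | ζ ≠ 0 ∧ α < ζ.arg ∧ ζ.arg < β}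

/-- The open ray `arg ζ = θ` issuing from `0`. -/
def pcRay (θ : ℝ) : Set ℂ := {ζ | ζ ≠ 0 ∧ ζ.arg = θ}

/-- `|arg ζ| < π / 4`. -/
def pcS0 : Set ℂ := pcSector (-(Real.pi / 4)) (Real.pi / 4)

/-- `π / 4 < arg ζ < 3 π / 4`. -/
def pcS1 : Set ℂ := pcSector (Real.pi / 4) (3 * Real.pi / 4)

/-- `-3 π / 4 < arg ζ < -π / 4`. -/
def pcSm1 : Set ℂ := pcSector (-(3 * Real.pi / 4)) (-(Real.pi / 4))

/-- `3 π / 4 < arg ζ < π`. -/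
def pcS2 : Set ℂ := pcSector (3 * Real.pi / 4) Real.pi

/-- `-π < arg ζ < -3 π / 4`. -/
def pcSm2 : Set ℂ := pcSector (-Real.pi) (-(3 * Real.pi / 4))

/-- The complement of the contour: the union of the five open sectors. -/
def pcDomain : Set ℂ := pcS0 ∪ pcS1 ∪ pcSm1 ∪ pcS2 ∪ pcSm2

/-- The matrix `diag (ζ ^ (i p σ̂₃), 1)`, `σ̂₃ = diag (1, -1)`, with principal powers. -/
def pcDiag (ζ : ℂ) : Matrix (Fin 3) (Fin 3) ℂ :=
  Matrix.diagonal ![ζ ^ (Complex.I * (pcP : ℂ)), ζ ^ (-(Complex.I * (pcP : ℂ))), 1]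

/-- `U` is holomorphic in `S` and extends continuously to the closure of `S`. -/
def pcRegularOn (U : ℂ → Matrix (Fin 3) (Fin 3) ℂ) (S : Set ℂ) : Prop :=
  (∀ i j, DifferentiableOn ℂ (fun ζ => U ζ i j) S) ∧
    ∀ z ∈ closure S, ∃ A : Matrix (Fin 3) (Fin 3) ℂ,
      Filter.Tendsto U (nhdsWithin z S) (nhds A)

/-- `U₊ = U₋ V` on `L`, where `U₊`, `U₋` are the boundary values of `U` taken from the regions
`Sp` (the left side of the oriented ray `L`) and `Sm` (its right side). -/
def pcJump (U : ℂ → Matrix (Fin 3) (Fin 3) ℂ) (L Sp Sm : Set ℂ)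
    (V : ℂ → Matrix (Fin 3) (Fin 3) ℂ) : Prop :=
  ∀ z ∈ L, ∃ Up Um : Matrix (Fin 3) (Fin 3) ℂ,
    Filter.Tendsto U (nhdsWithin z Sp) (nhds Up) ∧
    Filter.Tendsto U (nhdsWithin z Sm) (nhds Um) ∧ Up = Um * V z

/-- `U` solves the parabolic-cylinder Riemann-Hilbert problem. The rays `arg ζ = π / 4`,
`arg ζ = 3 π / 4`, `arg ζ = π` are oriented towards the origin, the rays
`arg ζ = -3 π / 4`, `arg ζ = -π / 4` away from it. -/
structure IsPCSolution (U : ℂ → Matrix (Fin 3) (Fin 3) ℂ) : Prop where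
  regular_S0 : pcRegularOn U pcS0
  regular_S1 : pcRegularOn U pcS1
  regular_Sm1 : pcRegularOn U pcSm1
  regular_S2 : pcRegularOn U pcS2
  regular_Sm2 : pcRegularOn U pcSm2
  jump_1 : pcJump U (pcRay (Real.pi / 4)) pcS0 pcS1 fun ζ =>
    !![1, 0, 0; -Complex.exp (Complex.I * ζ ^ 2), 1, 0; 0, 0, 1]
  jump_2 : pcJump U (pcRay (3 * Real.pi / 4)) pcS1 pcS2 fun ζ =>
    !![1, (1 / 2) * Complex.exp (-(Complex.I * ζ ^ 2)), 0; 0, 1, 0; 0, 0, 1]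
  jump_3 : pcJump U (pcRay Real.pi) pcS2 pcSm2 fun _ =>
    !![2, 0, 0; 0, 1 / 2, 0; 0, 0, 1]
  jump_4 : pcJump U (pcRay (-(3 * Real.pi / 4))) pcSm1 pcSm2 fun ζ =>
    !![1, 0, 0; -((1 / 2) * Complex.exp (Complex.I * ζ ^ 2)), 1, 0; 0, 0, 1]
  jump_5 : pcJump U (pcRay (-(Real.pi / 4))) pcS0 pcSm1 fun ζ =>
    !![1, Complex.exp (-(Complex.I * ζ ^ 2)), 0; 0, 1, 0; 0, 0, 1]
  normalization : Filter.Tendsto (fun ζ => U ζ * pcDiag ζ)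
    (Bornology.cobounded ℂ ⊓ Filter.principal pcDomain) (nhds 1)

/-- `U(ζ) diag (ζ ^ (i p σ̂₃), 1) = I + (2 i ζ)⁻¹ [[0, r, 0], [-s, 0, 0], [0, 0, 0]] + O(ζ⁻²)`,
entrywise, as `ζ → ∞` off the contour, uniformly in the direction. -/
def HasPCExpansion (U : ℂ → Matrix (Fin 3) (Fin 3) ℂ) (r s : ℂ) : Prop :=
  ∀ i j : Fin 3, Asymptotics.IsBigO (Bornology.cobounded ℂ ⊓ Filter.principal pcDomain)
    (fun ζ : ℂ => (U ζ * pcDiag ζ - 1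
      - (1 / (2 * Complex.I * ζ)) • (!![0, r, 0; -s, 0, 0; 0, 0, 0] :
          Matrix (Fin 3) (Fin 3) ℂ)) i j)
    (fun ζ : ℂ => (ζ ^ 2)⁻¹)

/-- `2^(5/4) exp (i (ln 2)² / (2 π)) √π exp (i π / 4) / Γ (i ln 2 / (2 π))`. -/
def pcR : ℂ :=
  (((2 : ℝ) ^ (5 / 4 : ℝ) : ℝ) : ℂ)
    * Complex.exp (Complex.I * ((Real.log 2 ^ 2 / (2 * Real.pi) : ℝ) : ℂ))
    * ((Real.sqrt Real.pi : ℝ) : ℂ)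
    * Complex.exp (Complex.I * ((Real.pi / 4 : ℝ) : ℂ))
    / Complex.Gamma (Complex.I * ((Real.log 2 / (2 * Real.pi) : ℝ) : ℂ))

end

/-!
The last row and column of the problem are trivial, so everything happens in the upper left
`2 × 2` block. Multiplying the columns of a solution by `exp (∓ i ζ² / 2)` makes all jumps constant
and turns the columns into solutions of the linear system `u' = -i ζ u + r v`, `v' = s u + i ζ v`,
which parabolic cylinder functions solve.

*Existence.* The functions are built from the entire function
`gaussLaplace a z = ∫₀^∞ exp (-z t - t² / 2) t ^ (a - 1) dt`, for which integration by parts gives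
a three-term recurrence. Each entry of the solution in each sector is a constant times `pcF` or
`pcH`, evaluated at a number `z = ±(1 ± i) ζ` that stays in the closed right half-plane,
so only the asymptotics there are needed. On the positive axis they are elementary; they extend
to the half-plane because
`z ^ a * gaussLaplace a z` has derivative `z ^ a * gaussLaplace (a + 2) z` in the variable `log z`,
and the recurrence shows this to be small (`gaussLaplace_asymptotic`). All five jumps follow from
one identity (`connection`) which writes the second column as a combination of the first column
and its reflection `ζ ↦ -ζ`. Its two sides solve the same system, so it is enough to compare them
at the origin, where the values are Gamma functions, matched by the duplication and reflection
formulas. This comparison is what fixes `r` and `s`.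

*Uniqueness.* The solution has determinant `1`, and if `U` is another solution then
`U * adjugate pcSol` has no jumps. It is continuous off the origin, holomorphic there by Painlevé's
theorem (the contour lies on three lines, and Morera's theorem removes one line at a time), bounded
near the origin and tends to `1` at infinity, hence it is `1` by Liouville's theorem.

The expansion determines `r` and `s`, so the values found for the explicit solution hold for every
solution; `|r|` follows from `s = -r^*` and `r s = -2 p`.
-/

noncomputable section

namespace PCRH

open Complex Set MeasureTheory Filter Topology Asymptotics

/-! ### The Laplace transform of the Gaussian -/

/-- The Laplace transform `∫₀^∞ exp (-z t - t² / 2) t ^ (a - 1) dt` of the Gaussian weighted by a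
power; up to elementary factors it is the parabolic cylinder function `D₋ₐ(z)`. It is meaningful
for `0 < re a`, where the integral converges for every complex `z`. -/
def gaussLaplace (a z : ℂ) : ℂ :=
  ∫ t : ℝ in Ioi 0, (t : ℂ) ^ (a - 1) * cexp (-(z * t) - (t : ℂ) ^ 2 / 2)

lemma norm_gaussLaplace_integrand {a z : ℂ} {t : ℝ} (ht : 0 < t) :
    ‖(t : ℂ) ^ (a - 1) * cexp (-(z * t) - (t : ℂ) ^ 2 / 2)‖ =
      t ^ (a.re - 1) * Real.exp (-(z.re * t) - t ^ 2 / 2) := by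
  rw [norm_mul, norm_cpow_eq_rpow_re_of_pos ht, norm_exp]
  congr 2
  have : (-(z * t) - (t : ℂ) ^ 2 / 2) = -(z * t) - ((t ^ 2 / 2 : ℝ) : ℂ) := by push_cast; ring
  rw [this, sub_re, neg_re, re_mul_ofReal, ofReal_re]

lemma continuousOn_gaussLaplace_integrand (a z : ℂ) :
    ContinuousOn (fun t : ℝ => (t : ℂ) ^ (a - 1) * cexp (-(z * t) - (t : ℂ) ^ 2 / 2)) (Ioi 0) := by
  apply ContinuousOn.mul
  · intro t ht
    exact (Complex.continuousAt_ofReal_cpow_const t (a - 1)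
      (Or.inr (ne_of_gt ht))).continuousWithinAt
  · fun_prop

/-- Completing the square: a linear exponent is absorbed by half of the Gaussian. -/
lemma exp_mul_sub_sq_le (R t : ℝ) :
    Real.exp (R * t - t ^ 2 / 2) ≤ Real.exp (R ^ 2) * Real.exp (-(1 / 4) * t ^ 2) := by
  rw [← Real.exp_add]
  apply Real.exp_le_exp.2
  nlinarith [sq_nonneg (R - t / 2)]

lemma integrableOn_rpow_mul_exp {σ : ℝ} (hσ : 0 < σ) (R : ℝ) :
    IntegrableOn (fun t : ℝ => t ^ (σ - 1) * Real.exp (R * t - t ^ 2 / 2)) (Ioi 0) := by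
  have h := (integrableOn_rpow_mul_exp_neg_mul_sq (b := 1 / 4) (by norm_num)
    (s := σ - 1) (by linarith)).const_mul (Real.exp (R ^ 2))
  refine Integrable.mono' h ?_ ?_
  · apply ContinuousOn.aestronglyMeasurable _ measurableSet_Ioi
    apply ContinuousOn.mul
    · exact fun t ht => (Real.continuousAt_rpow_const t _ (Or.inl (ne_of_gt ht))).continuousWithinAt
    · fun_prop
  · filter_upwards [ae_restrict_mem measurableSet_Ioi] with t ht
    have ht' : 0 ≤ t ^ (σ - 1) := Real.rpow_nonneg (le_of_lt ht) _
    rw [Real.norm_of_nonneg (mul_nonneg ht' (Real.exp_pos _).le)]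
    calc _ ≤ t ^ (σ - 1) * (Real.exp (R ^ 2) * Real.exp (-(1 / 4) * t ^ 2)) :=
          mul_le_mul_of_nonneg_left (exp_mul_sub_sq_le R t) ht'
      _ = _ := by ring

lemma integrableOn_gaussLaplace {a : ℂ} (ha : 0 < a.re) (z : ℂ) :
    IntegrableOn (fun t : ℝ => (t : ℂ) ^ (a - 1) * cexp (-(z * t) - (t : ℂ) ^ 2 / 2)) (Ioi 0) := by
  refine Integrable.mono' (integrableOn_rpow_mul_exp ha (-z.re))
    ((continuousOn_gaussLaplace_integrand a z).aestronglyMeasurable measurableSet_Ioi) ?_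
  filter_upwards [ae_restrict_mem measurableSet_Ioi] with t ht
  rw [norm_gaussLaplace_integrand ht, neg_mul]

lemma cpow_sub_one_mul {a : ℂ} {t : ℝ} (ht : 0 < t) :
    (t : ℂ) ^ (a - 1) * t = (t : ℂ) ^ a := by
  have h0 : (t : ℂ) ≠ 0 := ofReal_ne_zero.2 ht.ne'
  rw [cpow_sub _ _ h0, cpow_one, div_mul_cancel₀ _ h0]

/-- Differentiation under the integral sign. -/
lemma hasDerivAt_gaussLaplace {a : ℂ} (ha : 0 < a.re) (z : ℂ) :
    HasDerivAt (gaussLaplace a) (-gaussLaplace (a + 1) z) z := by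
  have ha1 : 0 < (a + 1).re := by simp; linarith
  have key := hasDerivAt_integral_of_dominated_loc_of_deriv_le
    (μ := volume.restrict (Ioi (0 : ℝ)))
    (F := fun (z : ℂ) (t : ℝ) => (t : ℂ) ^ (a - 1) * cexp (-(z * t) - (t : ℂ) ^ 2 / 2))
    (F' := fun (z : ℂ) (t : ℝ) =>
      -((t : ℂ) ^ (a + 1 - 1) * cexp (-(z * t) - (t : ℂ) ^ 2 / 2)))
    (x₀ := z) (s := Metric.ball z 1)
    (bound := fun t : ℝ => t ^ ((a + 1).re - 1) * Real.exp ((‖z‖ + 1) * t - t ^ 2 / 2))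
    (Metric.ball_mem_nhds z one_pos)
    (Eventually.of_forall fun w =>
      (continuousOn_gaussLaplace_integrand a w).aestronglyMeasurable measurableSet_Ioi)
    (integrableOn_gaussLaplace ha z)
    ((continuousOn_gaussLaplace_integrand (a + 1) z).neg.aestronglyMeasurable measurableSet_Ioi)
    ?_ (integrableOn_rpow_mul_exp ha1 _) ?_
  · have := key.2
    rw [integral_neg] at this
    exact this
  · filter_upwards [ae_restrict_mem measurableSet_Ioi] with t ht w hw
    rw [norm_neg, norm_gaussLaplace_integrand ht]
    have ht' : 0 < t := ht
    refine mul_le_mul_of_nonneg_left (Real.exp_le_exp.2 ?_) (Real.rpow_nonneg ht'.le _)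
    have h1 : -w.re ≤ ‖z‖ + 1 := by
      have h2 : ‖w‖ ≤ ‖z‖ + 1 := by
        have := norm_sub_norm_le w z
        rw [mem_ball_iff_norm] at hw
        linarith
      linarith [neg_abs_le w.re, Complex.abs_re_le_norm w]
    nlinarith
  · filter_upwards [ae_restrict_mem measurableSet_Ioi] with t ht w hw
    have h1 : HasDerivAt (fun w : ℂ => -(w * t) - (t : ℂ) ^ 2 / 2) (-(1 * (t : ℂ))) w :=
      (((hasDerivAt_id w).mul_const (t : ℂ)).neg).sub_const _
    have h2 := (h1.cexp).const_mul ((t : ℂ) ^ (a - 1))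
    refine h2.congr_deriv ?_
    rw [show a + 1 - 1 = a by ring, ← cpow_sub_one_mul (a := a) ht]
    ring

/-- Integration by parts. -/
lemma gaussLaplace_recurrence {a : ℂ} (ha : 0 < a.re) (z : ℂ) :
    a * gaussLaplace a z = z * gaussLaplace (a + 1) z + gaussLaplace (a + 2) z := by
  have ha1 : 0 < (a + 1).re := by simp; linarith
  have ha2 : 0 < (a + 2).re := by simp; linarith
  have ha0 : a ≠ 0 := fun h => by simp [h] at ha
  -- the boundary term of the integration by parts; it vanishes at `0` and at infinity
  set f : ℝ → ℂ := fun t => (t : ℂ) ^ a * cexp (-(z * t) - (t : ℂ) ^ 2 / 2) with hf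
  set E : ℂ → ℝ → ℂ := fun b t => (t : ℂ) ^ (b - 1) * cexp (-(z * t) - (t : ℂ) ^ 2 / 2) with hE
  have hderiv : ∀ t ∈ Ioi (0 : ℝ), HasDerivAt f (a * E a t - z * E (a + 1) t - E (a + 2) t) t := by
    intro t ht
    have h1 : HasDerivAt (fun t : ℝ => (t : ℂ) ^ a) (a * (t : ℂ) ^ (a - 1)) t := by
      have := ((hasDerivAt_id (t : ℂ)).cpow_const (c := a) (Or.inl ht)).comp_ofReal
      simpa using this
    have h2 : HasDerivAt (fun t : ℝ => -(z * (t : ℂ)) - (t : ℂ) ^ 2 / 2) (-(z * 1) - t) t := by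
      have hid : HasDerivAt (fun t : ℝ => (t : ℂ)) 1 t := Complex.ofRealCLM.hasDerivAt
      refine ((hid.const_mul z).neg.sub ((hid.pow 2).div_const 2)).congr_deriv ?_
      simp
    refine (h1.mul h2.cexp).congr_deriv ?_
    simp only [hE]
    rw [show a + 1 - 1 = a by ring, show a + 2 - 1 = a + 1 by ring,
      ← cpow_sub_one_mul (a := a + 1) ht, show a + 1 - 1 = a by ring]
    ring
  have hi : ∀ b : ℂ, 0 < b.re → IntegrableOn (E b) (Ioi 0) :=
    fun b hb => integrableOn_gaussLaplace hb z
  have hint : IntegrableOn (fun t => a * E a t - z * E (a + 1) t - E (a + 2) t) (Ioi 0) :=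
    (((hi a ha).const_mul a).sub ((hi _ ha1).const_mul z)).sub (hi _ ha2)
  have hcont : ContinuousWithinAt f (Ici 0) 0 := by
    apply ContinuousAt.continuousWithinAt
    apply ContinuousAt.mul
    · exact Complex.continuousAt_ofReal_cpow_const 0 a (Or.inl ha)
    · fun_prop
  have hlim : Tendsto f atTop (𝓝 0) := by
    rw [tendsto_zero_iff_norm_tendsto_zero]
    have hb : Tendsto (fun t : ℝ => Real.exp ((-z.re + 1) ^ 2) *
        (t ^ a.re * Real.exp (-1 * t))) atTop (𝓝 0) := by
      have := (tendsto_rpow_mul_exp_neg_mul_atTop_nhds_zero a.re 1 one_pos).const_mul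
        (Real.exp ((-z.re + 1) ^ 2))
      rwa [mul_zero] at this
    refine squeeze_zero' (Eventually.of_forall fun t => norm_nonneg _) ?_ hb
    filter_upwards [eventually_gt_atTop 0] with t ht
    have := norm_gaussLaplace_integrand (a := a + 1) (z := z) ht
    rw [add_sub_cancel_right] at this
    rw [hf, this]
    have h1 : Real.exp (-(z.re * t) - t ^ 2 / 2) ≤
        Real.exp ((-z.re + 1) ^ 2) * Real.exp (-1 * t) := by
      rw [← Real.exp_add]
      apply Real.exp_le_exp.2
      nlinarith [sq_nonneg ((-z.re + 1) - t / 2), sq_nonneg t]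
    have h2 : (a + 1).re - 1 = a.re := by simp
    rw [h2]
    calc _ ≤ t ^ a.re * (Real.exp ((-z.re + 1) ^ 2) * Real.exp (-1 * t)) :=
          mul_le_mul_of_nonneg_left h1 (Real.rpow_nonneg ht.le _)
      _ = _ := by ring
  have key := integral_Ioi_of_hasDerivAt_of_tendsto hcont hderiv hint hlim
  have hi12 : IntegrableOn (fun t => a * E a t - z * E (a + 1) t) (Ioi 0) :=
    ((hi a ha).const_mul a).sub ((hi _ ha1).const_mul z)
  rw [integral_sub hi12 (hi _ ha2),
    integral_sub ((hi a ha).const_mul a) ((hi _ ha1).const_mul z), integral_const_mul,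
    integral_const_mul] at key
  have hf0 : f 0 = 0 := by simp [hf, ha0]
  rw [hf0, sub_zero] at key
  change a * gaussLaplace a z - z * gaussLaplace (a + 1) z - gaussLaplace (a + 2) z = 0 at key
  linear_combination key

/-- The substitution `u = t² / 2` turns the integral into a Gamma integral. -/
lemma gaussLaplace_zero {a : ℂ} (ha : 0 < a.re) :
    gaussLaplace a 0 = 2 ^ (a / 2 - 1) * Gamma (a / 2) := by
  have ha2 : 0 < (a / 2).re := by
    have : (a / 2).re = a.re / 2 := by simp
    rw [this]; linarith
  have h1 : gaussLaplace a 0 =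
      mellin (fun t : ℝ => cexp (-((1 / 2 : ℝ) * (t ^ (2 : ℝ) : ℝ)))) a := by
    refine setIntegral_congr_fun measurableSet_Ioi fun t ht => ?_
    simp only [smul_eq_mul]
    congr 2
    push_cast
    rw [show (2 : ℝ) = ((2 : ℕ) : ℝ) by norm_num, Real.rpow_natCast]
    push_cast
    ring
  rw [h1, mellin_comp_rpow (fun t : ℝ => cexp (-((1 / 2 : ℝ) * (t : ℂ))))]
  have h2 := integral_cpow_mul_exp_neg_mul_Ioi ha2 (r := 1 / 2) (by norm_num)
  have h3 : mellin (fun t : ℝ => cexp (-((1 / 2 : ℝ) * (t : ℂ)))) (a / (2 : ℝ)) =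
      2 ^ (a / 2) * Gamma (a / 2) := by
    rw [mellin]
    simp only [smul_eq_mul, ofReal_ofNat]
    rw [h2]
    norm_num
  rw [h3, cpow_sub _ _ two_ne_zero, cpow_one, Complex.real_smul]
  norm_num
  ring

lemma gaussLaplace_bounded {a : ℂ} (ha : 0 < a.re) :
    ∃ C : ℝ, 0 ≤ C ∧ ∀ z : ℂ, 0 ≤ z.re → ‖gaussLaplace a z‖ ≤ C := by
  refine ⟨∫ t : ℝ in Ioi 0, t ^ (a.re - 1) * Real.exp (0 * t - t ^ 2 / 2), ?_, fun z hz => ?_⟩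
  · exact setIntegral_nonneg measurableSet_Ioi fun t ht =>
      mul_nonneg (Real.rpow_nonneg (le_of_lt ht) _) (Real.exp_pos _).le
  · refine norm_integral_le_of_norm_le (integrableOn_rpow_mul_exp ha 0) ?_
    filter_upwards [ae_restrict_mem measurableSet_Ioi] with t ht
    have ht' : 0 < t := ht
    rw [norm_gaussLaplace_integrand ht]
    refine mul_le_mul_of_nonneg_left (Real.exp_le_exp.2 ?_) (Real.rpow_nonneg ht'.le _)
    nlinarith [mul_nonneg hz ht'.le]

/-- On the positive axis the Gaussian is replaced by `1` at the cost of a relative error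
`O(x⁻²)`. -/
lemma norm_gaussLaplace_ofReal_sub_le {a : ℂ} (ha : 0 < a.re) {x : ℝ} (hx : 0 < x) :
    ‖(x : ℂ) ^ a * gaussLaplace a x - Gamma a‖ ≤ Real.Gamma (a.re + 2) / x ^ 2 := by
  have hG := integral_cpow_mul_exp_neg_mul_Ioi ha hx
  have hx0 : (x : ℂ) ≠ 0 := ofReal_ne_zero.2 hx.ne'
  have hxa : (x : ℂ) ^ a ≠ 0 := by simp [cpow_eq_zero_iff, hx.ne']
  have hinv : (1 / (x : ℂ)) ^ a = ((x : ℂ) ^ a)⁻¹ := by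
    rw [one_div, inv_cpow]
    rw [arg_ofReal_of_nonneg hx.le]; exact Real.pi_ne_zero.symm
  rw [hinv] at hG
  have hG' : Gamma a = (x : ℂ) ^ a * ∫ t : ℝ in Ioi 0, (t : ℂ) ^ (a - 1) * cexp (-(x * t)) := by
    rw [hG]; field_simp
  -- a divergent integral would have the value `0`, whereas the Gamma function has no zeros
  have hint2 : IntegrableOn (fun t : ℝ => (t : ℂ) ^ (a - 1) * cexp (-(x * t))) (Ioi 0) := by
    by_contra hcon
    have h0 : ∫ t : ℝ in Ioi 0, (t : ℂ) ^ (a - 1) * cexp (-(x * t)) = 0 := integral_undef hcon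
    rw [h0, mul_zero] at hG'
    exact Gamma_ne_zero_of_re_pos ha hG'
  rw [hG', ← mul_sub, gaussLaplace,
    ← integral_sub (integrableOn_gaussLaplace ha x) hint2, norm_mul,
    norm_cpow_eq_rpow_re_of_pos hx]
  have hR := Real.integral_rpow_mul_exp_neg_mul_Ioi (a := a.re + 2) (by linarith) hx
  have hRint : IntegrableOn (fun t : ℝ => t ^ (a.re + 2 - 1) * Real.exp (-(x * t))) (Ioi 0) := by
    by_contra hcon
    have h0 : ∫ t : ℝ in Ioi 0, t ^ (a.re + 2 - 1) * Real.exp (-(x * t)) = 0 := integral_undef hcon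
    rw [h0] at hR
    have : 0 < (1 / x) ^ (a.re + 2) * Real.Gamma (a.re + 2) :=
      mul_pos (Real.rpow_pos_of_pos (by positivity) _) (Real.Gamma_pos_of_pos (by linarith))
    linarith
  have hle : ‖∫ t : ℝ in Ioi 0, ((t : ℂ) ^ (a - 1) * cexp (-(x * t) - (t : ℂ) ^ 2 / 2) -
      (t : ℂ) ^ (a - 1) * cexp (-(x * t)))‖ ≤ (1 / x) ^ (a.re + 2) * Real.Gamma (a.re + 2) := by
    rw [← hR]
    refine norm_integral_le_of_norm_le hRint ?_
    filter_upwards [ae_restrict_mem measurableSet_Ioi] with t ht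
    have ht' : 0 < t := ht
    have e1 : (t : ℂ) ^ (a - 1) * cexp (-(x * t) - (t : ℂ) ^ 2 / 2) -
        (t : ℂ) ^ (a - 1) * cexp (-(x * t)) = (t : ℂ) ^ (a - 1) *
          ((Real.exp (-(x * t)) * (Real.exp (-(t ^ 2 / 2)) - 1) : ℝ) : ℂ) := by
      push_cast
      rw [sub_eq_add_neg (-((x : ℂ) * t)), Complex.exp_add]
      ring
    rw [e1, norm_mul, norm_cpow_eq_rpow_re_of_pos ht', norm_real, Real.norm_eq_abs, abs_mul,
      abs_of_pos (Real.exp_pos _)]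
    have e2 : |Real.exp (-(t ^ 2 / 2)) - 1| ≤ t ^ 2 := by
      rw [abs_le]
      constructor
      · nlinarith [Real.add_one_le_exp (-(t ^ 2 / 2)), sq_nonneg t]
      · have : Real.exp (-(t ^ 2 / 2)) ≤ 1 := Real.exp_le_one_iff.2 (by nlinarith [sq_nonneg t])
        nlinarith [sq_nonneg t]
    have e3 : t ^ (a.re + 2 - 1) = t ^ (a.re - 1) * t ^ 2 := by
      rw [show a.re + 2 - 1 = (a.re - 1) + (2 : ℕ) by push_cast; ring,
        Real.rpow_add_natCast ht'.ne']
    have e4 : (a - 1).re = a.re - 1 := by simp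
    rw [e3, e4]
    calc _ ≤ t ^ (a.re - 1) * (Real.exp (-(x * t)) * t ^ 2) :=
          mul_le_mul_of_nonneg_left (mul_le_mul_of_nonneg_left e2 (Real.exp_pos _).le)
            (Real.rpow_nonneg ht'.le _)
      _ = _ := by ring
  calc _ ≤ x ^ a.re * ((1 / x) ^ (a.re + 2) * Real.Gamma (a.re + 2)) :=
        mul_le_mul_of_nonneg_left hle (Real.rpow_nonneg hx.le _)
    _ = _ := by
      rw [one_div, Real.inv_rpow hx.le, show a.re + 2 = a.re + (2 : ℕ) by push_cast; ring,
        Real.rpow_add_natCast hx.ne']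
      have : x ^ a.re ≠ 0 := (Real.rpow_pos_of_pos hx _).ne'
      field_simp

/-! ### Asymptotics in the right half-plane -/

/-- `f = O(z⁻ᵐ)` in the closed right half-plane, uniformly in the direction. -/
def DecaysOnHalfPlane (f : ℂ → ℂ) (m : ℕ) : Prop :=
  ∃ C : ℝ, 0 ≤ C ∧ ∀ z : ℂ, 0 ≤ z.re → 1 ≤ ‖z‖ → ‖f z‖ ≤ C / ‖z‖ ^ m

lemma decaysOnHalfPlane_gaussLaplace_zero {a : ℂ} (ha : 0 < a.re) :
    DecaysOnHalfPlane (gaussLaplace a) 0 := by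
  obtain ⟨C, hC, h⟩ := gaussLaplace_bounded ha
  exact ⟨C, hC, fun z hz _ => by simpa using h z hz⟩

/-- Each use of the recurrence in the form `z G₁₊ₐ = a Gₐ - G₂₊ₐ` gains one power of `z`. -/
lemma DecaysOnHalfPlane.gaussLaplace_succ {a : ℂ} (ha : 0 < a.re) {m : ℕ}
    (h0 : DecaysOnHalfPlane (gaussLaplace a) m) (h2 : DecaysOnHalfPlane (gaussLaplace (a + 2)) m) :
    DecaysOnHalfPlane (gaussLaplace (a + 1)) (m + 1) := by
  obtain ⟨C, hC, h0⟩ := h0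
  obtain ⟨D, hD, h2⟩ := h2
  refine ⟨‖a‖ * C + D, by positivity, fun z hz hz1 => ?_⟩
  have hz0 : 0 < ‖z‖ := by linarith
  have hm : 0 < ‖z‖ ^ m := by positivity
  have key : z * gaussLaplace (a + 1) z = a * gaussLaplace a z - gaussLaplace (a + 2) z := by
    rw [gaussLaplace_recurrence ha]; ring
  have h3 : ‖z‖ * ‖gaussLaplace (a + 1) z‖ ≤ (‖a‖ * C + D) / ‖z‖ ^ m := by
    rw [← norm_mul, key]
    refine (norm_sub_le _ _).trans ?_
    rw [norm_mul, add_div, mul_div_assoc]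
    exact add_le_add (mul_le_mul_of_nonneg_left (h0 z hz hz1) (norm_nonneg _)) (h2 z hz hz1)
  rw [pow_succ, le_div_iff₀ (by positivity)]
  rw [le_div_iff₀ hm] at h3
  linarith

lemma decaysOnHalfPlane_gaussLaplace_add_one {a : ℂ} (ha : 0 < a.re) :
    DecaysOnHalfPlane (gaussLaplace (a + 1)) 1 :=
  (decaysOnHalfPlane_gaussLaplace_zero ha).gaussLaplace_succ ha
    (decaysOnHalfPlane_gaussLaplace_zero (by simp; linarith))

lemma decaysOnHalfPlane_gaussLaplace_add_two {a : ℂ} (ha : 0 < a.re) :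
    DecaysOnHalfPlane (gaussLaplace (a + 2)) 2 := by
  have h := (decaysOnHalfPlane_gaussLaplace_add_one ha).gaussLaplace_succ (by simp; linarith)
    (by
      have := decaysOnHalfPlane_gaussLaplace_add_one (a := a + 2) (by simp; linarith)
      rwa [add_right_comm] at this)
  rwa [add_assoc, one_add_one_eq_two] at h

/-- In the logarithmic variable `w = log z` the function `z ^ a * gaussLaplace a z` has derivative
`z ^ a * gaussLaplace (a + 2) z`. -/
lemma hasDerivAt_exp_mul_gaussLaplace_exp {a : ℂ} (ha : 0 < a.re) (w : ℂ) :
    HasDerivAt (fun w => cexp (w * a) * gaussLaplace a (cexp w))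
      (cexp (w * a) * gaussLaplace (a + 2) (cexp w)) w := by
  have h1 : HasDerivAt (fun w : ℂ => cexp (w * a)) (cexp (w * a) * (1 * a)) w :=
    ((hasDerivAt_id w).mul_const a).cexp
  have h2 := (hasDerivAt_gaussLaplace ha (cexp w)).comp w (Complex.hasDerivAt_exp w)
  refine (h1.mul h2).congr_deriv ?_
  simp only [Function.comp]
  linear_combination cexp (w * a) * gaussLaplace_recurrence ha (cexp w)

lemma abs_arg_le_pi_div_two {z : ℂ} (hz : 0 ≤ z.re) : |z.arg| ≤ Real.pi / 2 :=
  Complex.abs_arg_le_pi_div_two_iff.2 hz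

lemma norm_cpow_bounds {a z : ℂ} (hz : 0 ≤ z.re) (hz0 : z ≠ 0) :
    ‖z‖ ^ a.re * Real.exp (-(|a.im| * (Real.pi / 2))) ≤ ‖z ^ a‖ ∧
      ‖z ^ a‖ ≤ ‖z‖ ^ a.re * Real.exp (|a.im| * (Real.pi / 2)) := by
  have h : |z.arg * a.im| ≤ |a.im| * (Real.pi / 2) := by
    rw [abs_mul, mul_comm]
    exact mul_le_mul_of_nonneg_left (abs_arg_le_pi_div_two hz) (abs_nonneg _)
  have hp : 0 ≤ ‖z‖ ^ a.re := Real.rpow_nonneg (norm_nonneg _) _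
  rw [norm_cpow_of_ne_zero hz0, div_eq_mul_inv (‖z‖ ^ a.re), ← Real.exp_neg]
  rw [abs_le] at h
  exact ⟨mul_le_mul_of_nonneg_left (Real.exp_le_exp.2 (by linarith)) hp,
    mul_le_mul_of_nonneg_left (Real.exp_le_exp.2 (by linarith)) hp⟩

/-- The value on the positive axis is transported to `z` along the circular arc of radius `‖z‖`,
which is a vertical segment in the variable `log z`. -/
lemma norm_cpow_mul_gaussLaplace_sub_le {a : ℂ} (ha : a.re = 1) {m : ℕ}
    (h : DecaysOnHalfPlane (gaussLaplace (a + 2)) m) :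
    ∃ C : ℝ, 0 ≤ C ∧ ∀ z : ℂ, 0 ≤ z.re → 1 ≤ ‖z‖ →
      ‖z ^ a * gaussLaplace a z - Gamma a‖ ≤ C * (‖z‖ / ‖z‖ ^ m + 1 / ‖z‖ ^ 2) := by
  have ha0 : 0 < a.re := by rw [ha]; exact one_pos
  obtain ⟨C, hC, h⟩ := h
  set e := Real.exp (|a.im| * (Real.pi / 2)) with he
  have hepos : 0 < e := Real.exp_pos _
  have hΓ : 0 < Real.Gamma (a.re + 2) := Real.Gamma_pos_of_pos (by linarith)
  refine ⟨e * C * (Real.pi / 2) + Real.Gamma (a.re + 2), by positivity, fun z hz hz1 => ?_⟩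
  have hzpos : 0 < ‖z‖ := by linarith
  have hz0 : z ≠ 0 := norm_pos_iff.1 hzpos
  set K : ℂ → ℂ := fun w => cexp (w * a) * gaussLaplace a (cexp w) with hK
  have hKz : K (log z) = z ^ a * gaussLaplace a z := by
    simp only [hK, Complex.exp_log hz0, cpow_def_of_ne_zero hz0]
  have hx0 : (‖z‖ : ℂ) ≠ 0 := ofReal_ne_zero.2 hzpos.ne'
  have hKx : K (Real.log ‖z‖ : ℝ) = (‖z‖ : ℂ) ^ a * gaussLaplace a (‖z‖ : ℂ) := by
    simp only [hK]
    rw [ofReal_log hzpos.le, Complex.exp_log hx0, cpow_def_of_ne_zero hx0]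
  set S : Set ℂ := {w | w.re = Real.log ‖z‖} ∩ {w | |w.im| ≤ Real.pi / 2} with hS
  have hconv : Convex ℝ S := by
    apply Convex.inter
    · have : {w : ℂ | w.re = Real.log ‖z‖} = Complex.reLm ⁻¹' {Real.log ‖z‖} := by
        ext; simp
      rw [this]
      exact (convex_singleton _).linear_preimage Complex.reLm
    · have : {w : ℂ | |w.im| ≤ Real.pi / 2} =
          Complex.imLm ⁻¹' (Icc (-(Real.pi / 2)) (Real.pi / 2)) := by
        ext; simp [abs_le]
      rw [this]
      exact (convex_Icc _ _).linear_preimage Complex.imLm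
  have hbound : ∀ w ∈ S, ‖cexp (w * a) * gaussLaplace (a + 2) (cexp w)‖ ≤
      e * C * (‖z‖ / ‖z‖ ^ m) := by
    rintro w ⟨hw1, hw2⟩
    have hw1 : w.re = Real.log ‖z‖ := hw1
    have hw2 : |w.im| ≤ Real.pi / 2 := hw2
    have hn : ‖cexp w‖ = ‖z‖ := by rw [norm_exp, hw1, Real.exp_log hzpos]
    have hre : 0 ≤ (cexp w).re := by
      rw [exp_re]
      rw [abs_le] at hw2
      exact mul_nonneg (Real.exp_pos _).le (Real.cos_nonneg_of_neg_pi_div_two_le_of_le hw2.1 hw2.2)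
    have h1 := h (cexp w) hre (hn ▸ hz1)
    rw [hn] at h1
    have h2 : ‖cexp (w * a)‖ ≤ e * ‖z‖ := by
      rw [norm_exp, mul_re, ha, hw1, mul_one, he]
      nth_rewrite 2 [← Real.exp_log hzpos]
      rw [← Real.exp_add]
      apply Real.exp_le_exp.2
      have : |w.im * a.im| ≤ |a.im| * (Real.pi / 2) := by
        rw [abs_mul, mul_comm]
        exact mul_le_mul_of_nonneg_left hw2 (abs_nonneg _)
      linarith [neg_abs_le (w.im * a.im)]
    rw [norm_mul]
    calc _ ≤ (e * ‖z‖) * (C / ‖z‖ ^ m) :=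
          mul_le_mul h2 h1 (norm_nonneg _) (by positivity)
      _ = _ := by ring
  have hmem1 : log z ∈ S := ⟨log_re z, by
    change |(log z).im| ≤ _
    rw [log_im]; exact abs_arg_le_pi_div_two hz⟩
  have hmem2 : ((Real.log ‖z‖ : ℝ) : ℂ) ∈ S := ⟨ofReal_re _, by
    change |((Real.log ‖z‖ : ℝ) : ℂ).im| ≤ _
    rw [ofReal_im, abs_zero]; positivity⟩
  have hmv := hconv.norm_image_sub_le_of_norm_hasDerivWithin_le
    (fun w _ => (hasDerivAt_exp_mul_gaussLaplace_exp ha0 w).hasDerivWithinAt) hbound hmem2 hmem1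
  change ‖K _ - K _‖ ≤ _ at hmv
  have hdist : ‖log z - ((Real.log ‖z‖ : ℝ) : ℂ)‖ ≤ Real.pi / 2 := by
    have : log z - ((Real.log ‖z‖ : ℝ) : ℂ) = (z.arg : ℂ) * I := by
      apply Complex.ext <;> simp [log_re, log_im]
    rw [this, norm_mul, norm_I, mul_one, norm_real]
    exact abs_arg_le_pi_div_two hz
  rw [hKz, hKx] at hmv
  have hreal := norm_gaussLaplace_ofReal_sub_le ha0 hzpos
  have htri := norm_sub_le_norm_sub_add_norm_sub (z ^ a * gaussLaplace a z)
    ((‖z‖ : ℂ) ^ a * gaussLaplace a (‖z‖ : ℂ)) (Gamma a)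
  have hA : 0 ≤ ‖z‖ / ‖z‖ ^ m := by positivity
  have hB : 0 ≤ 1 / ‖z‖ ^ 2 := by positivity
  have h5 : e * C * (‖z‖ / ‖z‖ ^ m) * ‖log z - ((Real.log ‖z‖ : ℝ) : ℂ)‖ ≤
      e * C * (Real.pi / 2) * (‖z‖ / ‖z‖ ^ m) := by
    calc _ ≤ e * C * (‖z‖ / ‖z‖ ^ m) * (Real.pi / 2) :=
          mul_le_mul_of_nonneg_left hdist (by positivity)
      _ = _ := by ring
  have h6 : Real.Gamma (a.re + 2) / ‖z‖ ^ 2 = Real.Gamma (a.re + 2) * (1 / ‖z‖ ^ 2) := by ring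
  have h7 : 0 ≤ e * C * (Real.pi / 2) * (1 / ‖z‖ ^ 2) := by positivity
  have h8 : 0 ≤ Real.Gamma (a.re + 2) * (‖z‖ / ‖z‖ ^ m) := by positivity
  nlinarith

/-- A first, crude use of the transport along arcs; it improves the a priori bounds enough for the
second use in `gaussLaplace_asymptotic`. -/
lemma decaysOnHalfPlane_gaussLaplace_one {a : ℂ} (ha : a.re = 1) :
    DecaysOnHalfPlane (gaussLaplace a) 1 := by
  have ha0 : 0 < a.re := by rw [ha]; exact one_pos
  obtain ⟨C, hC, h⟩ := norm_cpow_mul_gaussLaplace_sub_le ha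
    (decaysOnHalfPlane_gaussLaplace_add_two ha0)
  set e := Real.exp (|a.im| * (Real.pi / 2)) with he
  have hepos : 0 < e := Real.exp_pos _
  refine ⟨e * (C * 2 + ‖Gamma a‖), by positivity, fun z hz hz1 => ?_⟩
  have hzpos : 0 < ‖z‖ := by linarith
  have hz0 : z ≠ 0 := norm_pos_iff.1 hzpos
  have h1 := h z hz hz1
  have h2 : ‖z‖ / ‖z‖ ^ 2 + 1 / ‖z‖ ^ 2 ≤ 2 := by
    have : ‖z‖ / ‖z‖ ^ 2 ≤ 1 := by
      rw [div_le_one (by positivity)]; nlinarith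
    have : 1 / ‖z‖ ^ 2 ≤ 1 := by
      rw [div_le_one (by positivity)]; nlinarith
    linarith
  have h3 : ‖z ^ a * gaussLaplace a z‖ ≤ C * 2 + ‖Gamma a‖ := by
    have := norm_sub_norm_le (z ^ a * gaussLaplace a z) (Gamma a)
    have := mul_le_mul_of_nonneg_left h2 hC
    linarith
  have h4 := (norm_cpow_bounds (a := a) hz hz0).1
  rw [ha, Real.rpow_one, Real.exp_neg, ← he] at h4
  rw [norm_mul] at h3
  rw [pow_one, le_div_iff₀ hzpos]
  have h5 : ‖z‖ * e⁻¹ * ‖gaussLaplace a z‖ ≤ C * 2 + ‖Gamma a‖ :=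
    (mul_le_mul_of_nonneg_right h4 (norm_nonneg _)).trans h3
  calc ‖gaussLaplace a z‖ * ‖z‖ = e * (‖z‖ * e⁻¹ * ‖gaussLaplace a z‖) := by field_simp
    _ ≤ _ := mul_le_mul_of_nonneg_left h5 hepos.le

lemma decaysOnHalfPlane_gaussLaplace_two {a : ℂ} (ha : a.re = 1) :
    DecaysOnHalfPlane (gaussLaplace (a + 1)) 2 := by
  have ha0 : 0 < a.re := by rw [ha]; exact one_pos
  refine (decaysOnHalfPlane_gaussLaplace_one ha).gaussLaplace_succ ha0 ?_
  have := decaysOnHalfPlane_gaussLaplace_add_one (a := a + 1) (by simp; linarith)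
  rwa [add_assoc, one_add_one_eq_two] at this

/-- The leading asymptotics in the closed right half-plane, with relative error `O(z⁻²)`. -/
lemma gaussLaplace_asymptotic {a : ℂ} (ha : a.re = 1) :
    DecaysOnHalfPlane (fun z => z ^ a * gaussLaplace a z - Gamma a) 2 := by
  have ha0 : 0 < a.re := by rw [ha]; exact one_pos
  have h3 : DecaysOnHalfPlane (gaussLaplace (a + 2)) 3 := by
    have := (decaysOnHalfPlane_gaussLaplace_two ha).gaussLaplace_succ (by simp; linarith) (by
      have := decaysOnHalfPlane_gaussLaplace_add_two (a := a + 1) (by simp; linarith)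
      exact this)
    rwa [add_assoc, one_add_one_eq_two] at this
  obtain ⟨C, hC, h⟩ := norm_cpow_mul_gaussLaplace_sub_le ha h3
  refine ⟨2 * C, by positivity, fun z hz hz1 => ?_⟩
  have hzpos : 0 < ‖z‖ := by linarith
  refine (h z hz hz1).trans (le_of_eq ?_)
  field_simp
  ring

/-- The function `(z G₁₊ᵢq(z) + G₂₊ᵢq(z)) / Γ(1 + i q)`, with `G = gaussLaplace`; it behaves like
`z ^ (-i q)` in the right half-plane and equals `exp (z² / 4) D₋ᵢq(z)`. -/
def pcF (q : ℝ) (z : ℂ) : ℂ :=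
  (z * gaussLaplace (1 + I * q) z + gaussLaplace (1 + I * q + 1) z) / Gamma (1 + I * q)

/-- The function `G₁₊ᵢq(z) / Γ(1 + i q)`, with `G = gaussLaplace`; it behaves like
`z ^ (-1 - i q)` in the right half-plane and equals `exp (z² / 4) D₋₁₋ᵢq(z)`. -/
def pcH (q : ℝ) (z : ℂ) : ℂ := gaussLaplace (1 + I * q) z / Gamma (1 + I * q)

lemma re_one_add_I_mul (q : ℝ) : (1 + I * (q : ℂ)).re = 1 := by simp

lemma Gamma_one_add_I_mul_ne_zero (q : ℝ) : Gamma (1 + I * (q : ℂ)) ≠ 0 :=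
  Gamma_ne_zero_of_re_pos (by rw [re_one_add_I_mul]; exact one_pos)

lemma cpow_one_add_I_mul {z : ℂ} (hz : z ≠ 0) (q : ℝ) :
    z ^ (1 + I * (q : ℂ)) = z * z ^ (I * (q : ℂ)) := by
  rw [cpow_add _ _ hz, cpow_one]

lemma pcF_asymptotic (q : ℝ) : DecaysOnHalfPlane (fun z => pcF q z * z ^ (I * (q : ℂ)) - 1) 2 := by
  obtain ⟨C, hC, h⟩ := gaussLaplace_asymptotic (re_one_add_I_mul q)
  obtain ⟨D, hD, h'⟩ := decaysOnHalfPlane_gaussLaplace_two (re_one_add_I_mul q)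
  have hΓ := Gamma_one_add_I_mul_ne_zero q
  have hΓ' : 0 < ‖Gamma (1 + I * (q : ℂ))‖ := norm_pos_iff.2 hΓ
  set e := Real.exp (|q| * (Real.pi / 2)) with he
  have hepos : 0 < e := Real.exp_pos _
  refine ⟨(C + D * e) / ‖Gamma (1 + I * (q : ℂ))‖, by positivity, fun z hz hz1 => ?_⟩
  have hzpos : 0 < ‖z‖ := by linarith
  have hz0 : z ≠ 0 := norm_pos_iff.1 hzpos
  have hcp : ‖z ^ (I * (q : ℂ))‖ ≤ e := by
    have := (norm_cpow_bounds (a := I * (q : ℂ)) hz hz0).2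
    simpa using this
  have e1 : pcF q z * z ^ (I * (q : ℂ)) - 1 =
      ((z ^ (1 + I * (q : ℂ)) * gaussLaplace (1 + I * q) z - Gamma (1 + I * q)) +
        gaussLaplace (1 + I * q + 1) z * z ^ (I * (q : ℂ))) / Gamma (1 + I * q) := by
    rw [pcF, cpow_one_add_I_mul hz0]
    field_simp
    ring
  simp only [e1, norm_div]
  rw [div_right_comm]
  refine div_le_div_of_nonneg_right ?_ hΓ'.le
  refine (norm_add_le _ _).trans ?_
  rw [add_div, norm_mul]
  refine add_le_add (h z hz hz1) ?_
  calc _ ≤ D / ‖z‖ ^ 2 * e := mul_le_mul (h' z hz hz1) hcp (norm_nonneg _) (by positivity)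
    _ = _ := by ring

lemma pcH_asymptotic (q : ℝ) :
    DecaysOnHalfPlane (fun z => pcH q z * z ^ (I * (q : ℂ)) - 1 / z) 3 := by
  obtain ⟨C, hC, h⟩ := gaussLaplace_asymptotic (re_one_add_I_mul q)
  have hΓ := Gamma_one_add_I_mul_ne_zero q
  have hΓ' : 0 < ‖Gamma (1 + I * (q : ℂ))‖ := norm_pos_iff.2 hΓ
  refine ⟨C / ‖Gamma (1 + I * (q : ℂ))‖, by positivity, fun z hz hz1 => ?_⟩
  have hzpos : 0 < ‖z‖ := by linarith
  have hz0 : z ≠ 0 := norm_pos_iff.1 hzpos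
  have e1 : pcH q z * z ^ (I * (q : ℂ)) - 1 / z =
      (z ^ (1 + I * (q : ℂ)) * gaussLaplace (1 + I * q) z - Gamma (1 + I * q)) /
        (Gamma (1 + I * q) * z) := by
    rw [pcH, cpow_one_add_I_mul hz0]
    field_simp
  simp only [e1, norm_div, norm_mul]
  rw [div_le_iff₀ (by positivity)]
  refine (h z hz hz1).trans (le_of_eq ?_)
  field_simp

lemma hasDerivAt_pcH (q : ℝ) (z : ℂ) : HasDerivAt (pcH q) (z * pcH q z - pcF q z) z := by
  have h := (hasDerivAt_gaussLaplace (a := 1 + I * q)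
    (by rw [re_one_add_I_mul]; exact one_pos) z).div_const (Gamma (1 + I * q))
  refine h.congr_deriv ?_
  rw [pcH, pcF]
  ring

lemma hasDerivAt_pcF (q : ℝ) (z : ℂ) : HasDerivAt (pcF q) (-(I * q) * pcH q z) z := by
  have h1 : 0 < (1 + I * (q : ℂ)).re := by rw [re_one_add_I_mul]; exact one_pos
  have h := (((hasDerivAt_id z).mul (hasDerivAt_gaussLaplace h1 z)).add
    (hasDerivAt_gaussLaplace (a := 1 + I * q + 1) (by simp) z)).div_const (Gamma (1 + I * q))
  refine h.congr_deriv ?_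
  have hrec := gaussLaplace_recurrence h1 z
  rw [pcH, show (1 + I * (q : ℂ) + 1 + 1) = 1 + I * q + 2 by ring]
  simp only [id]
  linear_combination (1 / Gamma (1 + I * (q : ℂ))) * hrec

lemma differentiable_pcF (q : ℝ) : Differentiable ℂ (pcF q) :=
  fun z => (hasDerivAt_pcF q z).differentiableAt

lemma differentiable_pcH (q : ℝ) : Differentiable ℂ (pcH q) :=
  fun z => (hasDerivAt_pcH q z).differentiableAt

/-! ### Constants -/

/-- The eighth root `2 ^ (1 / 8) = exp (π p / 4)` of `2`. -/
def pcY : ℝ := Real.exp (Real.log 2 / 8)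

/-- The phase `2 ^ (i q / 2)`. -/
def pcT (q : ℝ) : ℂ := cexp (I * q * (Real.log 2 / 2 : ℝ))

/-- The constant in front of the small entry of a column: `pcMu (-p)` for the first column, where
it is proportional to `s`, and `pcMu p` for the second one, where it is proportional to `r`. Its
value is forced by the connection formula at the origin. -/
def pcMu (q : ℝ) : ℂ := pcY ^ 6 * pcT q ^ 2 * (Real.sqrt Real.pi : ℝ) * q / Gamma (1 + I * q)

lemma pcY_pos : 0 < pcY := Real.exp_pos _

lemma pcY_pow_eight : pcY ^ 8 = 2 := by
  rw [pcY, ← Real.exp_nat_mul]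
  norm_num
  rw [show 8 * (Real.log 2 / 8) = Real.log 2 by ring, Real.exp_log two_pos]

lemma ofReal_pcY_pow_eight : (pcY : ℂ) ^ 8 = 2 := by
  rw [← ofReal_pow, pcY_pow_eight]; simp

lemma ofReal_pcY_ne_zero : (pcY : ℂ) ≠ 0 := ofReal_ne_zero.2 pcY_pos.ne'

lemma pcT_ne_zero (q : ℝ) : pcT q ≠ 0 := Complex.exp_ne_zero _

lemma pcT_neg (q : ℝ) : pcT (-q) = (pcT q)⁻¹ := by
  rw [pcT, pcT, ← Complex.exp_neg]; push_cast; ring_nf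

lemma two_cpow (z : ℂ) : (2 : ℂ) ^ z = cexp (z * Real.log 2) := by
  rw [cpow_def_of_ne_zero two_ne_zero, mul_comm]
  congr 2
  rw [show (2 : ℂ) = ((2 : ℝ) : ℂ) by simp, ← ofReal_log two_pos.le]

lemma two_cpow_half (q : ℝ) : (2 : ℂ) ^ (I * (q : ℂ) / 2) = pcT q := by
  rw [two_cpow, pcT]; push_cast; ring_nf

lemma two_cpow_neg_half : (2 : ℂ) ^ (-(1 / 2) : ℂ) = (pcY : ℂ)⁻¹ ^ 4 := by
  rw [two_cpow, pcY, inv_pow, ← ofReal_pow, ← Real.exp_nat_mul, ← ofReal_inv, ← Real.exp_neg,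
    ofReal_exp]
  push_cast; ring_nf

lemma pcP_pos : 0 < pcP := by
  have := Real.log_pos (one_lt_two)
  unfold pcP; positivity

lemma pi_mul_pcP : Real.pi * pcP = Real.log 2 / 2 := by
  unfold pcP; field_simp

/-! ### Values of the Gamma function -/

lemma Gamma_one_add_mul_Gamma_one_sub {x : ℝ} (hx : x ≠ 0) :
    Gamma (1 + I * (x : ℂ)) * Gamma (1 - I * x) = (Real.pi * x / Real.sinh (Real.pi * x) : ℝ) := by
  have hIx : I * (x : ℂ) ≠ 0 := mul_ne_zero I_ne_zero (ofReal_ne_zero.2 hx)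
  rw [add_comm, Gamma_add_one _ hIx, mul_assoc, Gamma_mul_Gamma_one_sub]
  rw [show (Real.pi : ℂ) * (I * x) = ((Real.pi * x : ℝ) : ℂ) * I by push_cast; ring,
    Complex.sin_mul_I]
  have hs : Real.sinh (Real.pi * x) ≠ 0 := by
    rw [Ne, Real.sinh_eq_zero]; exact mul_ne_zero Real.pi_ne_zero hx
  have hs' : Complex.sinh ((Real.pi * x : ℝ) : ℂ) ≠ 0 := by
    rw [← ofReal_sinh]; exact ofReal_ne_zero.2 hs
  rw [ofReal_div, ofReal_sinh]
  have := I_ne_zero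
  field_simp
  push_cast; ring

lemma sinh_pi_mul_pcP : Real.sinh (Real.pi * pcP) = 1 / pcY ^ 12 := by
  have h := pcY_pow_eight
  have hy := pcY_pos
  have e : Real.exp (Real.pi * pcP) = pcY ^ 4 := by
    rw [pi_mul_pcP, pcY, ← Real.exp_nat_mul]; push_cast; ring_nf
  rw [Real.sinh_eq, Real.exp_neg, e]
  field_simp
  nlinarith

lemma sinh_pi_mul_pcP_half : Real.sinh (Real.pi * (pcP / 2)) = (pcY ^ 4 - 1) / (2 * pcY ^ 2) := by
  have hy := pcY_pos
  have e : Real.exp (Real.pi * (pcP / 2)) = pcY ^ 2 := by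
    rw [← mul_div_assoc, pi_mul_pcP, pcY, ← Real.exp_nat_mul]; push_cast; ring_nf
  rw [Real.sinh_eq, Real.exp_neg, e]
  field_simp

lemma Gamma_mul_Gamma_pcP :
    Gamma (1 + I * (pcP : ℂ)) * Gamma (1 + I * ((-pcP : ℝ) : ℂ)) = Real.pi * pcP * pcY ^ 12 := by
  have h := Gamma_one_add_mul_Gamma_one_sub pcP_pos.ne'
  rw [sinh_pi_mul_pcP] at h
  rw [show 1 + I * ((-pcP : ℝ) : ℂ) = 1 - I * pcP by push_cast; ring, h]
  push_cast
  field_simp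

lemma Gamma_mul_Gamma_pcP_half :
    Gamma (1 + I * (pcP : ℂ) / 2) * Gamma (1 + I * ((-pcP : ℝ) : ℂ) / 2) * (pcY ^ 4 - 1) =
      Real.pi * pcP * pcY ^ 2 := by
  have h := Gamma_one_add_mul_Gamma_one_sub (x := pcP / 2) (by have := pcP_pos; positivity)
  rw [sinh_pi_mul_pcP_half] at h
  have h4 : 1 < pcY ^ 4 := by
    have : 1 < pcY := Real.one_lt_exp_iff.2 (by have := Real.log_pos one_lt_two; positivity)
    exact one_lt_pow₀ this (by norm_num)
  have h4' : (pcY : ℂ) ^ 4 - 1 ≠ 0 := by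
    rw [← ofReal_pow, ← ofReal_one, ← ofReal_sub]
    exact ofReal_ne_zero.2 (by linarith)
  rw [show 1 + I * (pcP : ℂ) / 2 = 1 + I * ((pcP / 2 : ℝ) : ℂ) by push_cast; ring,
    show 1 + I * ((-pcP : ℝ) : ℂ) / 2 = 1 - I * ((pcP / 2 : ℝ) : ℂ) by push_cast; ring, h]
  have hy := ofReal_pcY_ne_zero
  push_cast
  field_simp

lemma Gamma_duplication (q : ℝ) :
    Gamma (1 / 2 + I * (q : ℂ) / 2) * Gamma (1 + I * q / 2) * pcT q ^ 2 =
      Gamma (1 + I * q) * (Real.sqrt Real.pi : ℝ) := by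
  have h := Gamma_mul_Gamma_add_half (1 / 2 + I * (q : ℂ) / 2)
  rw [show (1 / 2 + I * (q : ℂ) / 2) + 1 / 2 = 1 + I * q / 2 by ring,
    show 2 * (1 / 2 + I * (q : ℂ) / 2) = 1 + I * q by ring] at h
  have h2 : (2 : ℂ) ^ (1 - (1 + I * (q : ℂ))) * pcT q ^ 2 = 1 := by
    rw [two_cpow, pcT, ← Complex.exp_nat_mul, ← Complex.exp_add]
    push_cast
    rw [← Complex.exp_zero]
    congr 1
    ring
  rw [h]
  linear_combination (Gamma (1 + I * q) * (Real.sqrt Real.pi : ℝ)) * h2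

lemma pcF_zero (q : ℝ) : pcF q 0 = pcT q * Gamma (1 + I * q / 2) / Gamma (1 + I * q) := by
  rw [pcF, gaussLaplace_zero (a := 1 + I * q + 1) (by simp), zero_mul, zero_add,
    show (1 + I * (q : ℂ) + 1) / 2 - 1 = I * q / 2 by ring, two_cpow_half,
    show (1 + I * (q : ℂ) + 1) / 2 = 1 + I * q / 2 by ring]

lemma pcH_zero (q : ℝ) :
    pcH q 0 = pcT q / pcY ^ 4 * Gamma (1 / 2 + I * q / 2) / Gamma (1 + I * q) := by
  rw [pcH, gaussLaplace_zero (by simp),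
    show (1 + I * (q : ℂ)) / 2 - 1 = I * q / 2 + -(1 / 2) by ring, cpow_add _ _ two_ne_zero,
    two_cpow_half, two_cpow_neg_half, show (1 + I * (q : ℂ)) / 2 = 1 / 2 + I * q / 2 by ring,
    inv_pow, ← div_eq_mul_inv]

lemma ofReal_sqrt_pi_sq : ((Real.sqrt Real.pi : ℝ) : ℂ) ^ 2 = Real.pi := by
  rw [← ofReal_pow, Real.sq_sqrt Real.pi_pos.le]

lemma pcMu_mul_pcMu_neg : pcMu pcP * pcMu (-pcP) = -(pcP : ℂ) := by
  have h := Gamma_mul_Gamma_pcP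
  have h1 := Gamma_one_add_I_mul_ne_zero pcP
  have h2 := Gamma_one_add_I_mul_ne_zero (-pcP)
  have hs := ofReal_sqrt_pi_sq
  have hT := pcT_ne_zero pcP
  rw [pcMu, pcMu, pcT_neg, div_mul_div_comm, div_eq_iff (mul_ne_zero h1 h2), h]
  field_simp
  rw [hs]
  push_cast
  ring

lemma Gamma_half_ne_zero (q : ℝ) : Gamma (1 + I * (q : ℂ) / 2) ≠ 0 := by
  apply Gamma_ne_zero_of_re_pos
  rw [show 1 + I * (q : ℂ) / 2 = 1 + I * ((q / 2 : ℝ) : ℂ) by push_cast; ring, re_one_add_I_mul]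
  exact one_pos

lemma Gamma_half_eq (q : ℝ) : Gamma (1 / 2 + I * (q : ℂ) / 2) =
    Gamma (1 + I * q) * (Real.sqrt Real.pi : ℝ) / (Gamma (1 + I * q / 2) * pcT q ^ 2) := by
  have h := Gamma_duplication q
  rw [eq_div_iff (mul_ne_zero (Gamma_half_ne_zero q) (pow_ne_zero 2 (pcT_ne_zero q))), ← h]
  ring

/-- The first component of the connection formula at the origin. -/
lemma connection_zero_fst :
    pcT pcP * pcF pcP 0 * (pcY ^ 4 - 1) = pcT (-pcP) * (pcMu pcP * pcH (-pcP) 0) := by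
  have h := Gamma_mul_Gamma_pcP_half
  have h1 := Gamma_one_add_I_mul_ne_zero pcP
  have h2 := Gamma_one_add_I_mul_ne_zero (-pcP)
  have h3 := Gamma_half_ne_zero pcP
  have h4 := Gamma_half_ne_zero (-pcP)
  have hs := ofReal_sqrt_pi_sq
  have hT := pcT_ne_zero pcP
  have hy := ofReal_pcY_ne_zero
  rw [pcF_zero, pcH_zero, pcMu, Gamma_half_eq (-pcP), pcT_neg]
  generalize Gamma (1 + I * (pcP : ℂ)) = g1 at *
  generalize Gamma (1 + I * ((-pcP : ℝ) : ℂ)) = g2 at *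
  generalize Gamma (1 + I * (pcP : ℂ) / 2) = g3 at *
  generalize Gamma (1 + I * ((-pcP : ℝ) : ℂ) / 2) = g4 at *
  field_simp
  rw [hs]
  linear_combination h

/-- The second component of the connection formula at the origin. -/
lemma connection_zero_snd :
    pcT pcP * (pcMu (-pcP) * pcH pcP 0) * (pcY ^ 4 + 1) = -(pcT (-pcP) * pcF (-pcP) 0) := by
  have h := Gamma_mul_Gamma_pcP_half
  have h1 := Gamma_one_add_I_mul_ne_zero pcP
  have h2 := Gamma_one_add_I_mul_ne_zero (-pcP)
  have h3 := Gamma_half_ne_zero pcP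
  have h4 := Gamma_half_ne_zero (-pcP)
  have hs := ofReal_sqrt_pi_sq
  have hT := pcT_ne_zero pcP
  have hy := ofReal_pcY_ne_zero
  have hy8 := ofReal_pcY_pow_eight
  rw [pcF_zero, pcH_zero, pcMu, Gamma_half_eq pcP, pcT_neg]
  generalize Gamma (1 + I * (pcP : ℂ)) = g1 at *
  generalize Gamma (1 + I * ((-pcP : ℝ) : ℂ)) = g2 at *
  generalize Gamma (1 + I * (pcP : ℂ) / 2) = g3 at *
  generalize Gamma (1 + I * ((-pcP : ℝ) : ℂ) / 2) = g4 at *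
  field_simp
  rw [hs]
  push_cast at h ⊢
  linear_combination ((pcY : ℂ) ^ 4 + 1) * h - g3 * g4 * hy8

/-! ### The linear system and the connection formula -/

/-- The upper entry of the first column of the solution in the sector around the positive axis. -/
def colA₁ (ζ : ℂ) : ℂ := pcT pcP / pcY * pcF pcP ((1 + I) * ζ)

/-- The lower entry of the first column of the solution in the sector around the positive axis. -/
def colA₂ (ζ : ℂ) : ℂ := pcT pcP / pcY * (pcMu (-pcP) * pcH pcP ((1 + I) * ζ))

/-- The upper entry of the second column of the solution in the sector around the positive axis. -/
def colB₁ (ζ : ℂ) : ℂ := pcT (-pcP) / pcY * (pcMu pcP * pcH (-pcP) ((1 - I) * ζ))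

/-- The lower entry of the second column of the solution in the sector around the positive axis. -/
def colB₂ (ζ : ℂ) : ℂ := pcT (-pcP) / pcY * pcF (-pcP) ((1 - I) * ζ)

/-- The pair of entire functions `(u, v)` solves the system `u' = -i ζ u + r v`,
`v' = s u + i ζ v`. -/
def IsSystemSolution (r s : ℂ) (u v : ℂ → ℂ) : Prop :=
  ∀ ζ, HasDerivAt u (-(I * ζ) * u ζ + r * v ζ) ζ ∧ HasDerivAt v (s * u ζ + I * ζ * v ζ) ζ

namespace IsSystemSolution

variable {r s : ℂ} {u v u' v' : ℂ → ℂ}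

lemma add (h : IsSystemSolution r s u v) (h' : IsSystemSolution r s u' v') :
    IsSystemSolution r s (fun ζ => u ζ + u' ζ) (fun ζ => v ζ + v' ζ) := fun ζ =>
  ⟨((h ζ).1.add (h' ζ).1).congr_deriv (by ring), ((h ζ).2.add (h' ζ).2).congr_deriv (by ring)⟩

lemma const_mul (h : IsSystemSolution r s u v) (c : ℂ) :
    IsSystemSolution r s (fun ζ => c * u ζ) (fun ζ => c * v ζ) := fun ζ =>
  ⟨((h ζ).1.const_mul c).congr_deriv (by ring), ((h ζ).2.const_mul c).congr_deriv (by ring)⟩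

lemma reflect (h : IsSystemSolution r s u v) :
    IsSystemSolution r s (fun ζ => u (-ζ)) (fun ζ => -v (-ζ)) := fun ζ =>
  ⟨((h (-ζ)).1.scomp ζ (hasDerivAt_neg ζ)).congr_deriv (by simp; ring),
    ((h (-ζ)).2.scomp ζ (hasDerivAt_neg ζ)).neg.congr_deriv (by simp)⟩

/-- The system has trace zero, so Wronskians are constant. -/
lemma wronskian_eq (h : IsSystemSolution r s u v) (h' : IsSystemSolution r s u' v') (ζ : ℂ) :
    u ζ * v' ζ - v ζ * u' ζ = u 0 * v' 0 - v 0 * u' 0 := by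
  have hd : ∀ ζ, HasDerivAt (fun ζ => u ζ * v' ζ - v ζ * u' ζ) 0 ζ := fun ζ =>
    (((h ζ).1.mul (h' ζ).2).sub ((h ζ).2.mul (h' ζ).1)).congr_deriv (by ring)
  exact is_const_of_deriv_eq_zero (fun ζ => (hd ζ).differentiableAt) (fun ζ => (hd ζ).deriv) ζ 0

end IsSystemSolution

/-- The upper right coefficient `r` of the system; it is also the coefficient `r` of the expansion
of the solution at infinity. -/
def pcr : ℂ := -((1 - I) * pcMu pcP)

/-- The lower left coefficient `s` of the system; it is also the coefficient `s` of the expansion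
of the solution at infinity. -/
def pcs : ℂ := -((1 + I) * pcMu (-pcP))

lemma hasDerivAt_gauss (c ζ : ℂ) :
    HasDerivAt (fun ζ : ℂ => cexp (c * ζ ^ 2 / 2)) (cexp (c * ζ ^ 2 / 2) * (c * ζ)) ζ := by
  have h := (((hasDerivAt_pow 2 ζ).const_mul c).div_const 2).cexp
  exact h.congr_deriv (by push_cast; ring)

lemma isSystemSolution_colA : IsSystemSolution pcr pcs
    (fun ζ => cexp (-I * ζ ^ 2 / 2) * colA₁ ζ) (fun ζ => cexp (-I * ζ ^ 2 / 2) * colA₂ ζ) := by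
  intro ζ
  have hl : HasDerivAt (fun ζ : ℂ => (1 + I) * ζ) (1 + I) ζ := by
    simpa using (hasDerivAt_id ζ).const_mul (1 + I)
  have hF := ((hasDerivAt_pcF pcP ((1 + I) * ζ)).comp ζ hl).const_mul (pcT pcP / pcY)
  have hH := (((hasDerivAt_pcH pcP ((1 + I) * ζ)).comp ζ hl).const_mul (pcMu (-pcP))).const_mul
    (pcT pcP / pcY)
  have hm := pcMu_mul_pcMu_neg
  have hI := I_sq
  refine ⟨((hasDerivAt_gauss (-I) ζ).mul hF).congr_deriv ?_,
    ((hasDerivAt_gauss (-I) ζ).mul hH).congr_deriv ?_⟩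
  · simp only [colA₁, colA₂, pcr, Function.comp]
    generalize pcH pcP _ = H
    generalize pcF pcP _ = F
    generalize cexp _ = e
    linear_combination (1 - I) * (e * (pcT pcP / pcY)) * H * hm -
      (e * (pcT pcP / pcY)) * H * pcP * hI
  · simp only [colA₁, colA₂, pcs, Function.comp]
    generalize pcH pcP _ = H
    generalize pcF pcP _ = F
    generalize cexp _ = e
    linear_combination e * (pcT pcP / pcY) * pcMu (-pcP) * H * ζ * hI

lemma isSystemSolution_colB : IsSystemSolution pcr pcs
    (fun ζ => cexp (I * ζ ^ 2 / 2) * colB₁ ζ) (fun ζ => cexp (I * ζ ^ 2 / 2) * colB₂ ζ) := by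
  intro ζ
  have hl : HasDerivAt (fun ζ : ℂ => (1 - I) * ζ) (1 - I) ζ := by
    simpa using (hasDerivAt_id ζ).const_mul (1 - I)
  have hF := ((hasDerivAt_pcF (-pcP) ((1 - I) * ζ)).comp ζ hl).const_mul (pcT (-pcP) / pcY)
  have hH := (((hasDerivAt_pcH (-pcP) ((1 - I) * ζ)).comp ζ hl).const_mul (pcMu pcP)).const_mul
    (pcT (-pcP) / pcY)
  have hm := pcMu_mul_pcMu_neg
  have hI := I_sq
  refine ⟨((hasDerivAt_gauss I ζ).mul hH).congr_deriv ?_,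
    ((hasDerivAt_gauss I ζ).mul hF).congr_deriv ?_⟩
  · simp only [colB₁, colB₂, pcr, Function.comp]
    generalize pcH (-pcP) _ = H
    generalize pcF (-pcP) _ = F
    generalize cexp _ = e
    linear_combination e * (pcT (-pcP) / pcY) * pcMu pcP * H * ζ * hI
  · simp only [colB₁, colB₂, pcs, Function.comp]
    generalize pcH (-pcP) _ = H
    generalize pcF (-pcP) _ = F
    generalize cexp _ = e
    push_cast
    linear_combination (1 + I) * (e * (pcT (-pcP) / pcY)) * H * hm -
      (e * (pcT (-pcP) / pcY)) * H * pcP * hI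

/-- The value that normalizes the Wronskian of the two columns at the origin. -/
lemma pcMu_neg_mul_pcF_mul_pcH_zero :
    pcT pcP ^ 2 * pcMu (-pcP) * pcF pcP 0 * pcH pcP 0 * (2 * pcY ^ 2) = -1 := by
  have h := Gamma_mul_Gamma_pcP
  have h1 := Gamma_one_add_I_mul_ne_zero pcP
  have h2 := Gamma_one_add_I_mul_ne_zero (-pcP)
  have h3 := Gamma_half_ne_zero pcP
  have hs := ofReal_sqrt_pi_sq
  have hT := pcT_ne_zero pcP
  have hy := ofReal_pcY_ne_zero
  have hy8 := ofReal_pcY_pow_eight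
  rw [pcF_zero, pcH_zero, pcMu, Gamma_half_eq pcP, pcT_neg]
  generalize Gamma (1 + I * (pcP : ℂ)) = g1 at *
  generalize Gamma (1 + I * ((-pcP : ℝ) : ℂ)) = g2 at *
  generalize Gamma (1 + I * (pcP : ℂ) / 2) = g3 at *
  field_simp
  rw [hs]
  push_cast
  linear_combination h + ((Real.pi : ℂ) * pcP * pcY ^ 4) * hy8

/-- The Wronskian of the two columns is `1`. -/
lemma colA_colB_det (ζ : ℂ) : colA₁ ζ * colB₂ ζ - colA₂ ζ * colB₁ ζ = 1 := by
  have h := isSystemSolution_colA.wronskian_eq isSystemSolution_colB ζ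
  have he : cexp (-I * ζ ^ 2 / 2) * cexp (I * ζ ^ 2 / 2) = 1 := by
    rw [← Complex.exp_add, ← Complex.exp_zero]; congr 1; ring
  have h0 : cexp (-I * 0 ^ 2 / 2) = 1 := by simp
  have h0' : cexp (I * 0 ^ 2 / 2) = 1 := by simp
  have h1 := connection_zero_fst
  have h2 := connection_zero_snd
  have h3 := pcMu_neg_mul_pcF_mul_pcH_zero
  have hy := ofReal_pcY_ne_zero
  have hval : colA₁ 0 * colB₂ 0 - colA₂ 0 * colB₁ 0 = 1 := by
    simp only [colA₁, colA₂, colB₁, colB₂, mul_zero]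
    generalize pcF pcP 0 = F at *
    generalize pcF (-pcP) 0 = F' at *
    generalize pcH pcP 0 = H at *
    generalize pcH (-pcP) 0 = H' at *
    have hy8 := ofReal_pcY_pow_eight
    field_simp
    linear_combination (pcT pcP * F) * h2 + pcT pcP * pcMu (-pcP) * H * h1 - pcY ^ 2 * h3
  simp only [h0, h0', one_mul] at h
  rw [hval] at h
  linear_combination h - (colA₁ ζ * colB₂ ζ - colA₂ ζ * colB₁ ζ) * he

/-- The connection formula: the second column is a combination of the first column and of its
reflection. The difference of the two sides, times `exp (i ζ² / 2)`, solves the system and vanishes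
at the origin, so its Wronskians with both columns vanish; as these are independent, it is zero. -/
lemma connection (ζ : ℂ) :
    colB₁ ζ = cexp (-I * ζ ^ 2) * (pcY ^ 4 * colA₁ (-ζ) - colA₁ ζ) ∧
      colB₂ ζ = cexp (-I * ζ ^ 2) * (-(pcY ^ 4 * colA₂ (-ζ)) - colA₂ ζ) := by
  have hA := isSystemSolution_colA
  have hB := isSystemSolution_colB
  have hD := (hB.add hA).add (hA.reflect.const_mul (-(pcY : ℂ) ^ 4))
  have hW := colA_colB_det ζ
  set u : ℂ → ℂ := fun ζ => cexp (I * ζ ^ 2 / 2) * colB₁ ζ + cexp (-I * ζ ^ 2 / 2) * colA₁ ζ +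
    -(pcY : ℂ) ^ 4 * (cexp (-I * (-ζ) ^ 2 / 2) * colA₁ (-ζ)) with hu
  set v : ℂ → ℂ := fun ζ => cexp (I * ζ ^ 2 / 2) * colB₂ ζ + cexp (-I * ζ ^ 2 / 2) * colA₂ ζ +
    -(pcY : ℂ) ^ 4 * -(cexp (-I * (-ζ) ^ 2 / 2) * colA₂ (-ζ)) with hv
  have hDA : u ζ * (cexp (-I * ζ ^ 2 / 2) * colA₂ ζ) - v ζ * (cexp (-I * ζ ^ 2 / 2) * colA₁ ζ) =
      u 0 * (cexp (-I * 0 ^ 2 / 2) * colA₂ 0) - v 0 * (cexp (-I * 0 ^ 2 / 2) * colA₁ 0) :=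
    hD.wronskian_eq hA ζ
  have hDB : u ζ * (cexp (I * ζ ^ 2 / 2) * colB₂ ζ) - v ζ * (cexp (I * ζ ^ 2 / 2) * colB₁ ζ) =
      u 0 * (cexp (I * 0 ^ 2 / 2) * colB₂ 0) - v 0 * (cexp (I * 0 ^ 2 / 2) * colB₁ 0) :=
    hD.wronskian_eq hB ζ
  have h1 := connection_zero_fst
  have h2 := connection_zero_snd
  have hu0 : u 0 = 0 := by
    simp only [hu, colA₁, colB₁]
    simp
    linear_combination (-1 / (pcY : ℂ)) * h1
  have hv0 : v 0 = 0 := by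
    simp only [hv, colA₂, colB₂]
    simp
    linear_combination (1 / (pcY : ℂ)) * h2
  simp only [hu0, hv0, zero_mul, sub_zero] at hDA hDB
  have he : cexp (-I * ζ ^ 2 / 2) * cexp (I * ζ ^ 2 / 2) = 1 := by
    rw [← Complex.exp_add, ← Complex.exp_zero]; congr 1; ring
  have he2 : cexp (-I * ζ ^ 2) = cexp (-I * ζ ^ 2 / 2) * cexp (-I * ζ ^ 2 / 2) := by
    rw [← Complex.exp_add]; congr 1; ring
  have hu1 : u ζ = 0 := by
    linear_combination (-u ζ) * hW + cexp (-I * ζ ^ 2 / 2) * colA₁ ζ * hDB -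
      cexp (I * ζ ^ 2 / 2) * colB₁ ζ * hDA - u ζ * (colA₁ ζ * colB₂ ζ - colA₂ ζ * colB₁ ζ) * he
  have hv1 : v ζ = 0 := by
    linear_combination (-v ζ) * hW + cexp (-I * ζ ^ 2 / 2) * colA₂ ζ * hDB -
      cexp (I * ζ ^ 2 / 2) * colB₂ ζ * hDA - v ζ * (colA₁ ζ * colB₂ ζ - colA₂ ζ * colB₁ ζ) * he
  simp only [hu, neg_sq] at hu1
  simp only [hv, neg_sq] at hv1
  rw [he2]
  exact ⟨by linear_combination cexp (-I * ζ ^ 2 / 2) * hu1 - colB₁ ζ * he,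
    by linear_combination cexp (-I * ζ ^ 2 / 2) * hv1 - colB₂ ζ * he⟩

/-! ### The sectors in Cartesian coordinates -/

lemma im_sub_re_eq (ζ : ℂ) :
    ζ.im - ζ.re = ‖ζ‖ * Real.sqrt 2 * Real.sin (ζ.arg - Real.pi / 4) := by
  have h2 : Real.sqrt 2 * Real.sqrt 2 = 2 := Real.mul_self_sqrt two_pos.le
  rw [Real.sin_sub, Real.cos_pi_div_four, Real.sin_pi_div_four]
  linear_combination (-1 : ℝ) * norm_mul_sin_arg ζ + norm_mul_cos_arg ζ -
    ‖ζ‖ * (Real.sin ζ.arg - Real.cos ζ.arg) / 2 * h2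

lemma im_add_re_eq (ζ : ℂ) :
    ζ.im + ζ.re = ‖ζ‖ * Real.sqrt 2 * Real.sin (ζ.arg + Real.pi / 4) := by
  have h2 : Real.sqrt 2 * Real.sqrt 2 = 2 := Real.mul_self_sqrt two_pos.le
  rw [Real.sin_add, Real.cos_pi_div_four, Real.sin_pi_div_four]
  linear_combination (-1 : ℝ) * norm_mul_sin_arg ζ - norm_mul_cos_arg ζ -
    ‖ζ‖ * (Real.sin ζ.arg + Real.cos ζ.arg) / 2 * h2

section Signs

variable {ζ : ℂ} (h0 : ζ ≠ 0)
include h0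

lemma norm_mul_sqrt_two_pos : 0 < ‖ζ‖ * Real.sqrt 2 := by
  have := norm_pos_iff.2 h0
  positivity

lemma im_lt_re_of_arg (h1 : -(3 * Real.pi / 4) < ζ.arg) (h2 : ζ.arg < Real.pi / 4) :
    ζ.im < ζ.re := by
  have := mul_neg_of_pos_of_neg (norm_mul_sqrt_two_pos h0)
    (Real.sin_neg_of_neg_of_neg_pi_lt (x := ζ.arg - Real.pi / 4) (by linarith) (by linarith))
  rw [← im_sub_re_eq] at this
  linarith

lemma re_lt_im_of_lt_arg (h1 : Real.pi / 4 < ζ.arg) : ζ.re < ζ.im := by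
  have hp := Real.pi_pos
  have := mul_pos (norm_mul_sqrt_two_pos h0)
    (Real.sin_pos_of_pos_of_lt_pi (x := ζ.arg - Real.pi / 4) (by linarith)
      (by linarith [arg_le_pi ζ]))
  rw [← im_sub_re_eq] at this
  linarith

lemma re_lt_im_of_arg_lt (h1 : ζ.arg < -(3 * Real.pi / 4)) : ζ.re < ζ.im := by
  have hp := Real.pi_pos
  have := mul_pos (norm_mul_sqrt_two_pos h0)
    (Real.sin_pos_of_pos_of_lt_pi (x := ζ.arg - Real.pi / 4 + 2 * Real.pi)
      (by linarith [neg_pi_lt_arg ζ]) (by linarith))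
  rw [Real.sin_add_two_pi, ← im_sub_re_eq] at this
  linarith

lemma im_add_re_pos_of_arg (h1 : -(Real.pi / 4) < ζ.arg) (h2 : ζ.arg < 3 * Real.pi / 4) :
    0 < ζ.im + ζ.re := by
  have := mul_pos (norm_mul_sqrt_two_pos h0)
    (Real.sin_pos_of_pos_of_lt_pi (x := ζ.arg + Real.pi / 4) (by linarith) (by linarith))
  rwa [← im_add_re_eq] at this

lemma im_add_re_neg_of_arg_lt (h1 : ζ.arg < -(Real.pi / 4)) : ζ.im + ζ.re < 0 := by
  have hp := Real.pi_pos
  have := mul_neg_of_pos_of_neg (norm_mul_sqrt_two_pos h0)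
    (Real.sin_neg_of_neg_of_neg_pi_lt (x := ζ.arg + Real.pi / 4) (by linarith)
      (by linarith [neg_pi_lt_arg ζ]))
  rwa [← im_add_re_eq] at this

lemma im_add_re_neg_of_lt_arg (h1 : 3 * Real.pi / 4 < ζ.arg) : ζ.im + ζ.re < 0 := by
  have hp := Real.pi_pos
  have := mul_neg_of_pos_of_neg (norm_mul_sqrt_two_pos h0)
    (Real.sin_neg_of_neg_of_neg_pi_lt (x := ζ.arg + Real.pi / 4 - 2 * Real.pi)
      (by linarith [arg_le_pi ζ]) (by linarith))
  rwa [Real.sin_sub_two_pi, ← im_add_re_eq] at this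

lemma im_pos_of_arg (h1 : 0 < ζ.arg) (h2 : ζ.arg < Real.pi) : 0 < ζ.im := by
  rw [← norm_mul_sin_arg]
  exact mul_pos (norm_pos_iff.2 h0) (Real.sin_pos_of_pos_of_lt_pi h1 h2)

end Signs

lemma im_eq_re_of_arg {ζ : ℂ} (h : ζ.arg = Real.pi / 4 ∨ ζ.arg = -(3 * Real.pi / 4)) :
    ζ.im = ζ.re := by
  rw [← sub_eq_zero, im_sub_re_eq]
  rcases h with h | h
  · rw [h]; simp
  · rw [h, show -(3 * Real.pi / 4) - Real.pi / 4 = -Real.pi by ring]; simp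

lemma im_add_re_eq_zero_of_arg {ζ : ℂ} (h : ζ.arg = -(Real.pi / 4) ∨ ζ.arg = 3 * Real.pi / 4) :
    ζ.im + ζ.re = 0 := by
  rw [im_add_re_eq]
  rcases h with h | h
  · rw [h]; simp
  · rw [h, show 3 * Real.pi / 4 + Real.pi / 4 = Real.pi by ring]; simp

/-- The position of a nonzero number among the sectors and rays, in polar and in Cartesian
coordinates. -/
lemma position (ζ : ℂ) (h0 : ζ ≠ 0) :
    (ζ ∈ pcS0 ∧ ζ.im < ζ.re ∧ 0 < ζ.im + ζ.re) ∨
    (ζ ∈ pcS1 ∧ ζ.re < ζ.im ∧ 0 < ζ.im + ζ.re) ∨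
    (ζ ∈ pcSm1 ∧ ζ.im < ζ.re ∧ ζ.im + ζ.re < 0) ∨
    (ζ ∈ pcS2 ∧ ζ.re < ζ.im ∧ ζ.im + ζ.re < 0 ∧ 0 < ζ.im) ∨
    (ζ ∈ pcSm2 ∧ ζ.re < ζ.im ∧ ζ.im + ζ.re < 0 ∧ ζ.im < 0) ∨
    (ζ.arg = Real.pi / 4 ∧ ζ.im = ζ.re ∧ 0 < ζ.im + ζ.re) ∨
    (ζ.arg = 3 * Real.pi / 4 ∧ ζ.re < ζ.im ∧ ζ.im + ζ.re = 0) ∨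
    (ζ.arg = Real.pi ∧ ζ.re < ζ.im ∧ ζ.im + ζ.re < 0 ∧ ζ.im = 0) ∨
    (ζ.arg = -(3 * Real.pi / 4) ∧ ζ.im = ζ.re ∧ ζ.im + ζ.re < 0) ∨
    (ζ.arg = -(Real.pi / 4) ∧ ζ.im < ζ.re ∧ ζ.im + ζ.re = 0) := by
  have hp := Real.pi_pos
  have hlt := neg_pi_lt_arg ζ
  rcases lt_trichotomy ζ.arg (-(3 * Real.pi / 4)) with h | h | h
  · exact Or.inr (Or.inr (Or.inr (Or.inr (Or.inl ⟨⟨h0, hlt, h⟩, re_lt_im_of_arg_lt h0 h,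
      im_add_re_neg_of_arg_lt h0 (by linarith), arg_neg_iff.1 (by linarith)⟩))))
  · exact Or.inr (Or.inr (Or.inr (Or.inr (Or.inr (Or.inr (Or.inr (Or.inr (Or.inl
      ⟨h, im_eq_re_of_arg (Or.inr h), im_add_re_neg_of_arg_lt h0 (by linarith)⟩))))))))
  rcases lt_trichotomy ζ.arg (-(Real.pi / 4)) with h' | h' | h'
  · exact Or.inr (Or.inr (Or.inl ⟨⟨h0, h, h'⟩, im_lt_re_of_arg h0 h (by linarith),
      im_add_re_neg_of_arg_lt h0 h'⟩))
  · exact Or.inr (Or.inr (Or.inr (Or.inr (Or.inr (Or.inr (Or.inr (Or.inr (Or.inr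
      ⟨h', im_lt_re_of_arg h0 h (by linarith), im_add_re_eq_zero_of_arg (Or.inl h')⟩))))))))
  rcases lt_trichotomy ζ.arg (Real.pi / 4) with h'' | h'' | h''
  · exact Or.inl ⟨⟨h0, h', h''⟩, im_lt_re_of_arg h0 h h'',
      im_add_re_pos_of_arg h0 h' (by linarith)⟩
  · exact Or.inr (Or.inr (Or.inr (Or.inr (Or.inr (Or.inl
      ⟨h'', im_eq_re_of_arg (Or.inl h''), im_add_re_pos_of_arg h0 h' (by linarith)⟩)))))
  rcases lt_trichotomy ζ.arg (3 * Real.pi / 4) with h3 | h3 | h3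
  · exact Or.inr (Or.inl ⟨⟨h0, h'', h3⟩, re_lt_im_of_lt_arg h0 h'',
      im_add_re_pos_of_arg h0 h' h3⟩)
  · exact Or.inr (Or.inr (Or.inr (Or.inr (Or.inr (Or.inr (Or.inl
      ⟨h3, re_lt_im_of_lt_arg h0 h'', im_add_re_eq_zero_of_arg (Or.inr h3)⟩))))))
  rcases (arg_le_pi ζ).lt_or_eq with h4 | h4
  · exact Or.inr (Or.inr (Or.inr (Or.inl ⟨⟨h0, h3, h4⟩, re_lt_im_of_lt_arg h0 h'',
      im_add_re_neg_of_lt_arg h0 h3, im_pos_of_arg h0 (by linarith) h4⟩)))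
  · exact Or.inr (Or.inr (Or.inr (Or.inr (Or.inr (Or.inr (Or.inr (Or.inl
      ⟨h4, re_lt_im_of_lt_arg h0 h'', im_add_re_neg_of_lt_arg h0 h3,
        (arg_eq_pi_iff.1 h4).2⟩)))))))

lemma mem_pcS0_iff {ζ : ℂ} : ζ ∈ pcS0 ↔ ζ.im < ζ.re ∧ 0 < ζ.im + ζ.re := by
  constructor
  · rintro ⟨h0, h1, h2⟩
    have hp := Real.pi_pos
    exact ⟨im_lt_re_of_arg h0 (by linarith) h2, im_add_re_pos_of_arg h0 h1 (by linarith)⟩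
  · rintro ⟨h1, h2⟩
    have h0 : ζ ≠ 0 := by rintro rfl; simp at h1
    rcases position ζ h0 with h | h | h | h | h | h | h | h | h | h
    on_goal 1 => exact h.1
    all_goals
      exfalso
      obtain ⟨-, h4, h5⟩ := h
      linarith

lemma mem_pcS1_iff {ζ : ℂ} : ζ ∈ pcS1 ↔ ζ.re < ζ.im ∧ 0 < ζ.im + ζ.re := by
  constructor
  · rintro ⟨h0, h1, h2⟩
    have hp := Real.pi_pos
    exact ⟨re_lt_im_of_lt_arg h0 h1, im_add_re_pos_of_arg h0 (by linarith) h2⟩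
  · rintro ⟨h1, h2⟩
    have h0 : ζ ≠ 0 := by rintro rfl; simp at h1
    rcases position ζ h0 with h | h | h | h | h | h | h | h | h | h
    on_goal 2 => exact h.1
    all_goals
      exfalso
      obtain ⟨-, h4, h5⟩ := h
      linarith

lemma mem_pcSm1_iff {ζ : ℂ} : ζ ∈ pcSm1 ↔ ζ.im < ζ.re ∧ ζ.im + ζ.re < 0 := by
  constructor
  · rintro ⟨h0, h1, h2⟩
    have hp := Real.pi_pos
    exact ⟨im_lt_re_of_arg h0 h1 (by linarith), im_add_re_neg_of_arg_lt h0 h2⟩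
  · rintro ⟨h1, h2⟩
    have h0 : ζ ≠ 0 := by rintro rfl; simp at h1
    rcases position ζ h0 with h | h | h | h | h | h | h | h | h | h
    on_goal 3 => exact h.1
    all_goals
      exfalso
      obtain ⟨-, h4, h5⟩ := h
      linarith

lemma mem_pcS2_iff {ζ : ℂ} : ζ ∈ pcS2 ↔ ζ.re < ζ.im ∧ ζ.im + ζ.re < 0 ∧ 0 < ζ.im := by
  constructor
  · rintro ⟨h0, h1, h2⟩
    have hp := Real.pi_pos
    exact ⟨re_lt_im_of_lt_arg h0 (by linarith),
      im_add_re_neg_of_lt_arg h0 h1,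
      im_pos_of_arg h0 (by linarith) h2⟩
  · rintro ⟨h1, h2, h3⟩
    have h0 : ζ ≠ 0 := by rintro rfl; simp at h1
    rcases position ζ h0 with h | h | h | h | h | h | h | h | h | h
    on_goal 4 => exact h.1
    all_goals
      exfalso
      obtain ⟨-, h4, h5⟩ := h
      linarith

lemma mem_pcSm2_iff {ζ : ℂ} : ζ ∈ pcSm2 ↔ ζ.re < ζ.im ∧ ζ.im + ζ.re < 0 ∧ ζ.im < 0 := by
  constructor
  · rintro ⟨h0, h1, h2⟩
    have hp := Real.pi_pos
    exact ⟨re_lt_im_of_arg_lt h0 h2,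
      im_add_re_neg_of_arg_lt h0 (by linarith), arg_neg_iff.1 (by linarith)⟩
  · rintro ⟨h1, h2, h3⟩
    have h0 : ζ ≠ 0 := by rintro rfl; simp at h1
    rcases position ζ h0 with h | h | h | h | h | h | h | h | h | h
    on_goal 5 => exact h.1
    all_goals
      exfalso
      obtain ⟨-, h4, h5⟩ := h
      linarith

lemma isOpen_pcS0 : IsOpen pcS0 := by
  have : pcS0 = {ζ : ℂ | ζ.im < ζ.re} ∩ {ζ | 0 < ζ.im + ζ.re} := by ext; exact mem_pcS0_iff
  rw [this]
  exact (isOpen_lt continuous_im continuous_re).inter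
    (isOpen_lt continuous_const (continuous_im.add continuous_re))

lemma isOpen_pcS1 : IsOpen pcS1 := by
  have : pcS1 = {ζ : ℂ | ζ.re < ζ.im} ∩ {ζ | 0 < ζ.im + ζ.re} := by ext; exact mem_pcS1_iff
  rw [this]
  exact (isOpen_lt continuous_re continuous_im).inter
    (isOpen_lt continuous_const (continuous_im.add continuous_re))

lemma isOpen_pcSm1 : IsOpen pcSm1 := by
  have : pcSm1 = {ζ : ℂ | ζ.im < ζ.re} ∩ {ζ | ζ.im + ζ.re < 0} := by ext; exact mem_pcSm1_iff
  rw [this]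
  exact (isOpen_lt continuous_im continuous_re).inter
    (isOpen_lt (continuous_im.add continuous_re) continuous_const)

lemma isOpen_pcS2 : IsOpen pcS2 := by
  have : pcS2 = {ζ : ℂ | ζ.re < ζ.im} ∩ ({ζ | ζ.im + ζ.re < 0} ∩ {ζ | 0 < ζ.im}) := by
    ext; exact mem_pcS2_iff
  rw [this]
  exact (isOpen_lt continuous_re continuous_im).inter
    ((isOpen_lt (continuous_im.add continuous_re) continuous_const).inter
      (isOpen_lt continuous_const continuous_im))

lemma isOpen_pcSm2 : IsOpen pcSm2 := by
  have : pcSm2 = {ζ : ℂ | ζ.re < ζ.im} ∩ ({ζ | ζ.im + ζ.re < 0} ∩ {ζ | ζ.im < 0}) := by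
    ext; exact mem_pcSm2_iff
  rw [this]
  exact (isOpen_lt continuous_re continuous_im).inter
    ((isOpen_lt (continuous_im.add continuous_re) continuous_const).inter
      (isOpen_lt continuous_im continuous_const))

lemma isOpen_pcDomain : IsOpen pcDomain :=
  (((isOpen_pcS0.union isOpen_pcS1).union isOpen_pcSm1).union isOpen_pcS2).union isOpen_pcSm2

/-- The contour lies on three lines through the origin. -/
lemma mem_pcDomain_of_ne {ζ : ℂ} (h1 : ζ.im ≠ ζ.re) (h2 : ζ.im + ζ.re ≠ 0) (h3 : ζ.im ≠ 0) :
    ζ ∈ pcDomain := by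
  have h0 : ζ ≠ 0 := by rintro rfl; simp at h3
  simp only [pcDomain, mem_union]
  rcases position ζ h0 with h | h | h | h | h | h | h | h | h | h
  · exact Or.inl (Or.inl (Or.inl (Or.inl h.1)))
  · exact Or.inl (Or.inl (Or.inl (Or.inr h.1)))
  · exact Or.inl (Or.inl (Or.inr h.1))
  · exact Or.inl (Or.inr h.1)
  · exact Or.inr h.1
  · exact absurd h.2.1 h1
  · exact absurd h.2.2 h2
  · exact absurd h.2.2.2 h3
  · exact absurd h.2.1 h1
  · exact absurd h.2.2 h2

lemma dense_im_mul_ne {u : ℂ} (hu : u ≠ 0) : Dense {ζ : ℂ | (u * ζ).im ≠ 0} :=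
  (dense_compl_singleton (0 : ℝ)).preimage
    (isOpenMap_im.comp (Homeomorph.mulLeft₀ u hu).isOpenMap)

lemma one_add_I_ne_zero : (1 + I : ℂ) ≠ 0 := fun h => by simpa using congrArg Complex.re h

lemma one_sub_I_ne_zero : (1 - I : ℂ) ≠ 0 := fun h => by simpa using congrArg Complex.re h

lemma one_add_I_mul_im (ζ : ℂ) : ((1 + I) * ζ).im = ζ.im + ζ.re := by simp

lemma one_sub_I_mul_im (ζ : ℂ) : ((1 - I) * ζ).im = ζ.im - ζ.re := by simp; ring

lemma isOpen_im_mul_ne (u : ℂ) : IsOpen {ζ : ℂ | (u * ζ).im ≠ 0} :=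
  isOpen_ne_fun (by fun_prop) continuous_const

lemma dense_pcDomain : Dense pcDomain := by
  have h := (((dense_im_mul_ne one_add_I_ne_zero).inter_of_isOpen_left
    (dense_im_mul_ne one_sub_I_ne_zero) (isOpen_im_mul_ne _)).inter_of_isOpen_left
    (dense_im_mul_ne one_ne_zero) ((isOpen_im_mul_ne _).inter (isOpen_im_mul_ne _)))
  refine h.mono ?_
  rintro ζ ⟨⟨h1, h2⟩, h3⟩
  simp only [mem_ofPred_eq, one_add_I_mul_im, one_sub_I_mul_im, one_mul] at h1 h2 h3
  exact mem_pcDomain_of_ne (fun h => h2 (by linarith)) h1 h3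

/-- Two sectors fill the domain near each point of the ray between them. -/
lemma nhdsWithin_pcDomain_le {z : ℂ} {N Sp Sm : Set ℂ} (hN : IsOpen N) (hz : z ∈ N)
    (h : N ∩ pcDomain ⊆ Sp ∪ Sm) : 𝓝[pcDomain] z ≤ 𝓝[Sp] z ⊔ 𝓝[Sm] z := by
  rw [← nhdsWithin_union, ← nhdsWithin_inter_of_mem' (mem_nhdsWithin_of_mem_nhds (hN.mem_nhds hz))]
  exact nhdsWithin_mono _ (fun w hw => h ⟨hw.2, hw.1⟩)

lemma mem_pcDomain_iff {ζ : ℂ} : ζ ∈ pcDomain ↔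
    ζ ∈ pcS0 ∨ ζ ∈ pcS1 ∨ ζ ∈ pcSm1 ∨ ζ ∈ pcS2 ∨ ζ ∈ pcSm2 := by
  simp only [pcDomain, mem_union]; tauto

lemma nhdsWithin_ray_one {z : ℂ} (hz : z ∈ pcRay (Real.pi / 4)) :
    𝓝[pcDomain] z ≤ 𝓝[pcS0] z ⊔ 𝓝[pcS1] z := by
  have hp := Real.pi_pos
  refine nhdsWithin_pcDomain_le (N := {ζ : ℂ | 0 < ζ.im + ζ.re})
    (isOpen_lt continuous_const (continuous_im.add continuous_re))
    (im_add_re_pos_of_arg hz.1 (by rw [hz.2]; linarith) (by rw [hz.2]; linarith)) ?_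
  rintro w ⟨h1 : 0 < w.im + w.re, h2⟩
  rcases mem_pcDomain_iff.1 h2 with h | h | h | h | h
  · exact Or.inl h
  · exact Or.inr h
  · rw [mem_pcSm1_iff] at h; linarith [h.2]
  · rw [mem_pcS2_iff] at h; linarith [h.2.1]
  · rw [mem_pcSm2_iff] at h; linarith [h.2.1]

lemma nhdsWithin_ray_two {z : ℂ} (hz : z ∈ pcRay (3 * Real.pi / 4)) :
    𝓝[pcDomain] z ≤ 𝓝[pcS1] z ⊔ 𝓝[pcS2] z := by
  have hp := Real.pi_pos
  refine nhdsWithin_pcDomain_le (N := {ζ : ℂ | ζ.re < ζ.im} ∩ {ζ : ℂ | 0 < ζ.im})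
    ((isOpen_lt continuous_re continuous_im).inter (isOpen_lt continuous_const continuous_im))
    ⟨re_lt_im_of_lt_arg hz.1 (by rw [hz.2]; linarith),
      im_pos_of_arg hz.1 (by rw [hz.2]; linarith) (by rw [hz.2]; linarith)⟩ ?_
  rintro w ⟨⟨h1 : w.re < w.im, h3 : 0 < w.im⟩, h2⟩
  rcases mem_pcDomain_iff.1 h2 with h | h | h | h | h
  · rw [mem_pcS0_iff] at h; linarith [h.1]
  · exact Or.inl h
  · rw [mem_pcSm1_iff] at h; linarith [h.1]
  · exact Or.inr h
  · rw [mem_pcSm2_iff] at h; linarith [h.2.2]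

lemma nhdsWithin_ray_three {z : ℂ} (hz : z ∈ pcRay Real.pi) :
    𝓝[pcDomain] z ≤ 𝓝[pcS2] z ⊔ 𝓝[pcSm2] z := by
  have hp := Real.pi_pos
  refine nhdsWithin_pcDomain_le (N := {ζ : ℂ | ζ.re < ζ.im} ∩ {ζ : ℂ | ζ.im + ζ.re < 0})
    ((isOpen_lt continuous_re continuous_im).inter
      (isOpen_lt (continuous_im.add continuous_re) continuous_const))
    ⟨re_lt_im_of_lt_arg hz.1 (by rw [hz.2]; linarith),
      im_add_re_neg_of_lt_arg hz.1 (by rw [hz.2]; linarith)⟩ ?_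
  rintro w ⟨⟨h1 : w.re < w.im, h3 : w.im + w.re < 0⟩, h2⟩
  rcases mem_pcDomain_iff.1 h2 with h | h | h | h | h
  · rw [mem_pcS0_iff] at h; linarith [h.1]
  · rw [mem_pcS1_iff] at h; linarith [h.2]
  · rw [mem_pcSm1_iff] at h; linarith [h.1]
  · exact Or.inl h
  · exact Or.inr h

lemma nhdsWithin_ray_four {z : ℂ} (hz : z ∈ pcRay (-(3 * Real.pi / 4))) :
    𝓝[pcDomain] z ≤ 𝓝[pcSm1] z ⊔ 𝓝[pcSm2] z := by
  have hp := Real.pi_pos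
  refine nhdsWithin_pcDomain_le (N := {ζ : ℂ | ζ.im < 0} ∩ {ζ : ℂ | ζ.im + ζ.re < 0})
    ((isOpen_lt continuous_im continuous_const).inter
      (isOpen_lt (continuous_im.add continuous_re) continuous_const))
    ⟨arg_neg_iff.1 (by rw [hz.2]; linarith),
      im_add_re_neg_of_arg_lt hz.1 (by rw [hz.2]; linarith)⟩ ?_
  rintro w ⟨⟨h1 : w.im < 0, h3 : w.im + w.re < 0⟩, h2⟩
  rcases mem_pcDomain_iff.1 h2 with h | h | h | h | h
  · rw [mem_pcS0_iff] at h; linarith [h.2]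
  · rw [mem_pcS1_iff] at h; linarith [h.2]
  · exact Or.inl h
  · rw [mem_pcS2_iff] at h; linarith [h.2.2]
  · exact Or.inr h

lemma nhdsWithin_ray_five {z : ℂ} (hz : z ∈ pcRay (-(Real.pi / 4))) :
    𝓝[pcDomain] z ≤ 𝓝[pcS0] z ⊔ 𝓝[pcSm1] z := by
  have hp := Real.pi_pos
  refine nhdsWithin_pcDomain_le (N := {ζ : ℂ | ζ.im < ζ.re})
    (isOpen_lt continuous_im continuous_re)
    (im_lt_re_of_arg hz.1 (by rw [hz.2]; linarith) (by rw [hz.2]; linarith)) ?_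
  rintro w ⟨h1 : w.im < w.re, h2⟩
  rcases mem_pcDomain_iff.1 h2 with h | h | h | h | h
  · exact Or.inl h
  · rw [mem_pcS1_iff] at h; linarith [h.1]
  · exact Or.inr h
  · rw [mem_pcS2_iff] at h; linarith [h.1]
  · rw [mem_pcSm2_iff] at h; linarith [h.1]

/-! ### Painlevé's theorem across a line -/

/-- Cauchy's theorem for rectangles on one side of the real axis, possibly with an edge on it. -/
lemma rect_integral_eq_zero_of_le {f : ℂ → ℂ} {U : Set ℂ} (hc : ContinuousOn f U)
    (hd : ∀ ζ ∈ U, ζ.im ≠ 0 → DifferentiableAt ℂ f ζ) {z w : ℂ}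
    (h : uIcc z.re w.re ×ℂ uIcc z.im w.im ⊆ U)
    (hside : 0 ≤ min z.im w.im ∨ max z.im w.im ≤ 0) :
    (∫ x : ℝ in z.re..w.re, f (x + z.im * I)) - (∫ x : ℝ in z.re..w.re, f (x + w.im * I)) +
      I • (∫ y : ℝ in z.im..w.im, f (w.re + y * I)) -
      I • (∫ y : ℝ in z.im..w.im, f (z.re + y * I)) = 0 := by
  refine integral_boundary_rect_eq_zero_of_continuousOn_of_differentiableOn f z w (hc.mono h) ?_
  rintro ζ ⟨h1, h2⟩
  refine (hd ζ (h ⟨?_, ?_⟩) ?_).differentiableWithinAt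
  · exact ⟨h1.1.le, h1.2.le⟩
  · exact ⟨h2.1.le, h2.2.le⟩
  · rcases hside with hs | hs
    · exact (lt_of_le_of_lt hs h2.1).ne'
    · exact (lt_of_lt_of_le h2.2 hs).ne

/-- A continuous function that is holomorphic off the real axis is holomorphic: rectangles that
meet the axis are cut along it, and Morera's theorem applies. -/
lemma differentiableOn_of_off_real {f : ℂ → ℂ} {U : Set ℂ} (hU : IsOpen U)
    (hc : ContinuousOn f U) (hd : ∀ ζ ∈ U, ζ.im ≠ 0 → DifferentiableAt ℂ f ζ) :
    DifferentiableOn ℂ f U := by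
  rw [← isConservativeOn_and_continuousOn_iff_isDifferentiableOn hU]
  refine ⟨fun z w hzw => ?_, hc⟩
  rw [← add_eq_zero_iff_eq_neg, wedgeIntegral_add_wedgeIntegral_eq]
  have hzw' : uIcc z.re w.re ×ℂ uIcc z.im w.im ⊆ U := hzw
  by_cases h1 : 0 ≤ min z.im w.im
  · exact rect_integral_eq_zero_of_le hc hd hzw' (Or.inl h1)
  by_cases h2 : max z.im w.im ≤ 0
  · exact rect_integral_eq_zero_of_le hc hd hzw' (Or.inr h2)
  push Not at h1 h2
  have h0 : (0 : ℝ) ∈ uIcc z.im w.im := ⟨h1.le, h2.le⟩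
  have hside1 : 0 ≤ min z.im 0 ∨ max z.im 0 ≤ 0 := by
    rcases le_total 0 z.im with h | h
    · left; simp [h]
    · right; simp [h]
  have hside2 : 0 ≤ min 0 w.im ∨ max 0 w.im ≤ 0 := by
    rcases le_total 0 w.im with h | h
    · left; simp [h]
    · right; simp [h]
  have e1 := rect_integral_eq_zero_of_le hc hd (z := z) (w := ⟨w.re, 0⟩)
    (fun ζ hζ => hzw' ⟨hζ.1, uIcc_subset_uIcc left_mem_uIcc h0 hζ.2⟩) hside1
  have e2 := rect_integral_eq_zero_of_le hc hd (z := ⟨z.re, 0⟩) (w := w)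
    (fun ζ hζ => hzw' ⟨hζ.1, uIcc_subset_uIcc h0 right_mem_uIcc hζ.2⟩) hside2
  have hvert : ∀ x ∈ uIcc z.re w.re, ∀ c ∈ uIcc z.im w.im, ∀ d ∈ uIcc z.im w.im,
      IntervalIntegrable (fun y : ℝ => f (x + y * I)) volume c d := by
    intro x hx c hc' d hd'
    apply ContinuousOn.intervalIntegrable
    refine hc.comp (by fun_prop) (fun y hy => hzw' ⟨?_, ?_⟩)
    · simpa using hx
    · simpa using uIcc_subset_uIcc hc' hd' hy
  have a1 := intervalIntegral.integral_add_adjacent_intervals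
    (hvert w.re right_mem_uIcc z.im left_mem_uIcc 0 h0)
    (hvert w.re right_mem_uIcc 0 h0 w.im right_mem_uIcc)
  have a2 := intervalIntegral.integral_add_adjacent_intervals
    (hvert z.re left_mem_uIcc z.im left_mem_uIcc 0 h0)
    (hvert z.re left_mem_uIcc 0 h0 w.im right_mem_uIcc)
  rw [← a1, ← a2]
  simp only [smul_eq_mul] at e1 e2 ⊢
  linear_combination e1 + e2

lemma differentiableOn_of_off_line {f : ℂ → ℂ} {U : Set ℂ} (hU : IsOpen U) {u : ℂ} (hu : u ≠ 0)
    (hc : ContinuousOn f U) (hd : ∀ ζ ∈ U, (u * ζ).im ≠ 0 → DifferentiableAt ℂ f ζ) :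
    DifferentiableOn ℂ f U := by
  have hcont : Continuous fun ζ : ℂ => u⁻¹ * ζ := by fun_prop
  have h := differentiableOn_of_off_real (f := fun ζ => f (u⁻¹ * ζ))
    (U := (fun ζ => u⁻¹ * ζ) ⁻¹' U) (hU.preimage hcont)
    (hc.comp hcont.continuousOn (fun ζ hζ => hζ)) (fun ζ hζ h0 => by
      have := hd (u⁻¹ * ζ) hζ (by rwa [mul_inv_cancel_left₀ hu])
      exact this.comp ζ (by fun_prop))
  have h2 : DifferentiableOn ℂ (fun ζ => f (u⁻¹ * (u * ζ))) U :=
    h.comp (by fun_prop : DifferentiableOn ℂ (fun ζ => u * ζ) U) (fun ζ hζ => by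
      change u⁻¹ * (u * ζ) ∈ U
      rwa [inv_mul_cancel_left₀ hu])
  simpa only [inv_mul_cancel_left₀ hu] using h2

/-! ### Liouville's theorem for sectionally holomorphic functions without jumps -/

/-- The three lines through the origin that carry the contour are removed one after another. -/
lemma differentiableOn_compl_zero_of_off_contour {g : ℂ → ℂ} (hc : ContinuousOn g {0}ᶜ)
    (hd : ∀ ζ ∈ pcDomain, DifferentiableAt ℂ g ζ) : DifferentiableOn ℂ g {0}ᶜ := by
  have hO : IsOpen ({0}ᶜ : Set ℂ) := isOpen_compl_singleton
  have h1 : DifferentiableOn ℂ g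
      ({0}ᶜ ∩ ({ζ : ℂ | ((1 + I) * ζ).im ≠ 0} ∩ {ζ : ℂ | ((1 - I) * ζ).im ≠ 0})) := by
    refine differentiableOn_of_off_line (hO.inter ((isOpen_im_mul_ne _).inter (isOpen_im_mul_ne _)))
      one_ne_zero (hc.mono inter_subset_left) (fun ζ hζ h => hd ζ ?_)
    have h2 := hζ.2.1
    have h3 := hζ.2.2
    simp only [mem_ofPred_eq, one_add_I_mul_im, one_sub_I_mul_im, one_mul] at h2 h3 h
    exact mem_pcDomain_of_ne (fun h => h3 (by linarith)) h2 h
  have h2 : DifferentiableOn ℂ g ({0}ᶜ ∩ {ζ : ℂ | ((1 + I) * ζ).im ≠ 0}) := by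
    refine differentiableOn_of_off_line (hO.inter (isOpen_im_mul_ne _))
      one_sub_I_ne_zero (hc.mono inter_subset_left) (fun ζ hζ h => ?_)
    exact (h1 ζ ⟨hζ.1, hζ.2, h⟩).differentiableAt
      ((hO.inter ((isOpen_im_mul_ne _).inter (isOpen_im_mul_ne _))).mem_nhds ⟨hζ.1, hζ.2, h⟩)
  refine differentiableOn_of_off_line hO one_add_I_ne_zero hc (fun ζ hζ h => ?_)
  exact (h2 ζ ⟨hζ, h⟩).differentiableAt ((hO.inter (isOpen_im_mul_ne _)).mem_nhds ⟨hζ, h⟩)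

lemma exists_limit_pcDomain {f : ℂ → ℂ} (hd : DifferentiableOn ℂ f pcDomain)
    (h1 : ∀ z ∈ pcRay (Real.pi / 4), ∃ y, Tendsto f (𝓝[pcS0] z ⊔ 𝓝[pcS1] z) (𝓝 y))
    (h2 : ∀ z ∈ pcRay (3 * Real.pi / 4), ∃ y, Tendsto f (𝓝[pcS1] z ⊔ 𝓝[pcS2] z) (𝓝 y))
    (h3 : ∀ z ∈ pcRay Real.pi, ∃ y, Tendsto f (𝓝[pcS2] z ⊔ 𝓝[pcSm2] z) (𝓝 y))
    (h4 : ∀ z ∈ pcRay (-(3 * Real.pi / 4)), ∃ y, Tendsto f (𝓝[pcSm1] z ⊔ 𝓝[pcSm2] z) (𝓝 y))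
    (h5 : ∀ z ∈ pcRay (-(Real.pi / 4)), ∃ y, Tendsto f (𝓝[pcS0] z ⊔ 𝓝[pcSm1] z) (𝓝 y))
    {z : ℂ} (hz : z ≠ 0) : ∃ y, Tendsto f (𝓝[pcDomain] z) (𝓝 y) := by
  have hin : z ∈ pcDomain → ∃ y, Tendsto f (𝓝[pcDomain] z) (𝓝 y) :=
    fun h => ⟨f z, (hd z h).continuousWithinAt⟩
  rcases position z hz with h | h | h | h | h | h | h | h | h | h
  · exact hin (mem_pcDomain_iff.2 (Or.inl h.1))
  · exact hin (mem_pcDomain_iff.2 (Or.inr (Or.inl h.1)))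
  · exact hin (mem_pcDomain_iff.2 (Or.inr (Or.inr (Or.inl h.1))))
  · exact hin (mem_pcDomain_iff.2 (Or.inr (Or.inr (Or.inr (Or.inl h.1)))))
  · exact hin (mem_pcDomain_iff.2 (Or.inr (Or.inr (Or.inr (Or.inr h.1)))))
  · obtain ⟨y, hy⟩ := h1 z ⟨hz, h.1⟩
    exact ⟨y, hy.mono_left (nhdsWithin_ray_one ⟨hz, h.1⟩)⟩
  · obtain ⟨y, hy⟩ := h2 z ⟨hz, h.1⟩
    exact ⟨y, hy.mono_left (nhdsWithin_ray_two ⟨hz, h.1⟩)⟩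
  · obtain ⟨y, hy⟩ := h3 z ⟨hz, h.1⟩
    exact ⟨y, hy.mono_left (nhdsWithin_ray_three ⟨hz, h.1⟩)⟩
  · obtain ⟨y, hy⟩ := h4 z ⟨hz, h.1⟩
    exact ⟨y, hy.mono_left (nhdsWithin_ray_four ⟨hz, h.1⟩)⟩
  · obtain ⟨y, hy⟩ := h5 z ⟨hz, h.1⟩
    exact ⟨y, hy.mono_left (nhdsWithin_ray_five ⟨hz, h.1⟩)⟩

/-- A function holomorphic off the contour that has limits at all points of the open rays, is
bounded near the origin and has a limit at infinity is constant. -/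
lemma eq_of_no_jumps {f : ℂ → ℂ} {c : ℂ} (hd : DifferentiableOn ℂ f pcDomain)
    (hlim : ∀ z : ℂ, z ≠ 0 → ∃ y, Tendsto f (𝓝[pcDomain] z) (𝓝 y))
    (h0 : ∃ C : ℝ, ∀ᶠ ζ in 𝓝[pcDomain] 0, ‖f ζ‖ ≤ C)
    (hinf : Tendsto f (Bornology.cobounded ℂ ⊓ 𝓟 pcDomain) (𝓝 c)) :
    ∀ ζ ∈ pcDomain, f ζ = c := by
  set g := extendFrom pcDomain f with hg
  have hgf : ∀ ζ ∈ pcDomain, g ζ = f ζ := extendFrom_extends hd.continuousOn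
  have hgc : ContinuousOn g {0}ᶜ :=
    continuousOn_extendFrom (fun z _ => dense_pcDomain z) (fun z hz => hlim z hz)
  have hgd : DifferentiableOn ℂ g {0}ᶜ := by
    refine differentiableOn_compl_zero_of_off_contour hgc (fun ζ hζ => ?_)
    refine ((hd ζ hζ).differentiableAt (isOpen_pcDomain.mem_nhds hζ)).congr_of_eventuallyEq ?_
    filter_upwards [isOpen_pcDomain.mem_nhds hζ] with w hw using hgf w hw
  -- a bound on the dense set `pcDomain` passes to all of an open set away from `0`
  have hext : ∀ (V : Set ℂ) (a : ℂ) (C : ℝ), IsOpen V → V ⊆ {0}ᶜ →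
      (∀ ζ ∈ V ∩ pcDomain, ‖f ζ - a‖ ≤ C) → ∀ ζ ∈ V, ‖g ζ - a‖ ≤ C := by
    intro V a C hV hV0 hb ζ hζ
    have hmem : ζ ∈ closure (V ∩ pcDomain) := dense_pcDomain.open_subset_closure_inter hV hζ
    have := mem_closure_iff_nhdsWithin_neBot.1 hmem
    have ht : Tendsto (fun w => ‖g w - a‖) (𝓝[V ∩ pcDomain] ζ) (𝓝 ‖g ζ - a‖) :=
      (((hgc.continuousAt (isOpen_compl_singleton.mem_nhds (hV0 hζ))).sub
        continuousAt_const).norm).tendsto.mono_left nhdsWithin_le_nhds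
    refine le_of_tendsto ht ?_
    filter_upwards [self_mem_nhdsWithin] with w hw
    rw [hgf w hw.2]
    exact hb w hw
  obtain ⟨C, hC⟩ := h0
  obtain ⟨ε, hε, hball⟩ := Metric.mem_nhdsWithin_iff.1 hC
  have hbound : ∀ ζ ∈ Metric.ball (0 : ℂ) ε \ {0}, ‖g ζ‖ ≤ C := by
    intro ζ hζ
    have := hext (Metric.ball (0 : ℂ) ε \ {0}) 0 C (Metric.isOpen_ball.sdiff isClosed_singleton)
      (fun w hw => hw.2) (fun w hw => by
        rw [sub_zero]; exact hball ⟨hw.1.1, hw.2⟩) ζ hζ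
    rwa [sub_zero] at this
  have hrem := differentiableOn_update_limUnder_of_bddAbove (f := g)
    (Metric.ball_mem_nhds (0 : ℂ) hε) (hgd.mono (fun w hw => hw.2))
    ⟨C, by rintro _ ⟨ζ, hζ, rfl⟩; exact hbound ζ hζ⟩
  set G := Function.update g 0 (limUnder (𝓝[≠] 0) g) with hG
  have hGg : ∀ ζ : ℂ, ζ ≠ 0 → G ζ = g ζ := fun ζ hζ => Function.update_of_ne hζ _ _
  have hGd : Differentiable ℂ G := by
    intro ζ
    by_cases hζ : ζ = 0
    · rw [hζ]
      exact (hrem 0 (Metric.mem_ball_self hε)).differentiableAt (Metric.ball_mem_nhds 0 hε)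
    · have hn := isOpen_compl_singleton.mem_nhds (show ζ ∈ ({0}ᶜ : Set ℂ) from hζ)
      refine ((hgd ζ hζ).differentiableAt hn).congr_of_eventuallyEq ?_
      filter_upwards [hn] with w hw using hGg w hw
  have hGinf : Tendsto G (cocompact ℂ) (𝓝 c) := by
    rw [← Metric.cobounded_eq_cocompact, Metric.tendsto_nhds]
    intro δ hδ
    have h1 := (Metric.tendsto_nhds.1 hinf) (δ / 2) (by linarith)
    rw [eventually_inf_principal, ← comap_norm_atTop, eventually_comap] at h1
    obtain ⟨R, hR⟩ := eventually_atTop.1 h1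
    have hV : IsOpen {ζ : ℂ | max R 0 < ‖ζ‖} := isOpen_lt continuous_const continuous_norm
    have hb := hext {ζ : ℂ | max R 0 < ‖ζ‖} c (δ / 2) hV (fun ζ hζ h => by
      have hζ' : max R 0 < ‖ζ‖ := hζ
      rw [mem_singleton_iff.1 h, norm_zero] at hζ'
      exact absurd hζ' (not_lt.2 (le_max_right _ _))) (fun ζ hζ => by
        have hζ' : max R 0 < ‖ζ‖ := hζ.1
        rw [← dist_eq_norm]
        exact (hR ‖ζ‖ ((le_max_left _ _).trans hζ'.le) ζ rfl hζ.2).le)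
    filter_upwards [tendsto_norm_cobounded_atTop.eventually_gt_atTop (max R 0)] with ζ hζ
    have hζ0 : ζ ≠ 0 := norm_pos_iff.1 (lt_of_le_of_lt (le_max_right R 0) hζ)
    rw [hGg ζ hζ0, dist_eq_norm]
    exact (hb ζ hζ).trans_lt (by linarith)
  intro ζ hζ
  have hζ0 : ζ ≠ 0 := by
    rcases mem_pcDomain_iff.1 hζ with h | h | h | h | h <;> exact h.1
  rw [← hgf ζ hζ, ← hGg ζ hζ0]
  exact hGd.apply_eq_of_tendsto_cocompact ζ hGinf

/-! ### The solution and its jumps -/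

/-- The `3 × 3` matrix with columns `(u₁, u₂, 0)`, `(v₁, v₂, 0)`, `(0, 0, 1)`. -/
def blockMatrix (u₁ u₂ v₁ v₂ : ℂ) : Matrix (Fin 3) (Fin 3) ℂ :=
  !![u₁, v₁, 0; u₂, v₂, 0; 0, 0, 1]

/-- The solution in `S₀`, continued to the plane. -/
def solS0 (ζ : ℂ) : Matrix (Fin 3) (Fin 3) ℂ := blockMatrix (colA₁ ζ) (colA₂ ζ) (colB₁ ζ) (colB₂ ζ)

/-- The solution in `S₁`, continued to the plane. The factor `pcY ^ 4 = √2` comes from the branch of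
the powers: `-(1 + i) ζ` has argument `arg ζ - 3 π / 4` there. -/
def solS1 (ζ : ℂ) : Matrix (Fin 3) (Fin 3) ℂ :=
  blockMatrix (pcY ^ 4 * colA₁ (-ζ)) (-(pcY ^ 4 * colA₂ (-ζ))) (colB₁ ζ) (colB₂ ζ)

/-- The solution in `S₋₁`, continued to the plane. -/
def solSm1 (ζ : ℂ) : Matrix (Fin 3) (Fin 3) ℂ :=
  blockMatrix (colA₁ ζ) (colA₂ ζ) (-(pcY ^ 4 * colB₁ (-ζ))) (pcY ^ 4 * colB₂ (-ζ))

/-- The solution in `S₂`, continued to the plane. -/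
def solS2 (ζ : ℂ) : Matrix (Fin 3) (Fin 3) ℂ :=
  blockMatrix (pcY ^ 4 * colA₁ (-ζ)) (-(pcY ^ 4 * colA₂ (-ζ)))
    (-(colB₁ (-ζ) / pcY ^ 4)) (colB₂ (-ζ) / pcY ^ 4)

/-- The solution in `S₋₂`, continued to the plane. -/
def solSm2 (ζ : ℂ) : Matrix (Fin 3) (Fin 3) ℂ :=
  blockMatrix (colA₁ (-ζ) / pcY ^ 4) (-(colA₂ (-ζ) / pcY ^ 4))
    (-(pcY ^ 4 * colB₁ (-ζ))) (pcY ^ 4 * colB₂ (-ζ))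

open Classical in
/-- The solution of the Riemann-Hilbert problem; its values on the contour are immaterial. -/
def pcSol (ζ : ℂ) : Matrix (Fin 3) (Fin 3) ℂ :=
  if ζ ∈ pcS0 then solS0 ζ else if ζ ∈ pcS1 then solS1 ζ else if ζ ∈ pcSm1 then solSm1 ζ
  else if ζ ∈ pcS2 then solS2 ζ else solSm2 ζ

lemma differentiable_colA₁ : Differentiable ℂ colA₁ :=
  ((differentiable_pcF pcP).comp
    (by fun_prop : Differentiable ℂ fun ζ : ℂ => (1 + I) * ζ)).const_mul _

lemma differentiable_colA₂ : Differentiable ℂ colA₂ :=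
  (((differentiable_pcH pcP).comp
    (by fun_prop : Differentiable ℂ fun ζ : ℂ => (1 + I) * ζ)).const_mul _).const_mul _

lemma differentiable_colB₁ : Differentiable ℂ colB₁ :=
  (((differentiable_pcH (-pcP)).comp
    (by fun_prop : Differentiable ℂ fun ζ : ℂ => (1 - I) * ζ)).const_mul _).const_mul _

lemma differentiable_colB₂ : Differentiable ℂ colB₂ :=
  ((differentiable_pcF (-pcP)).comp
    (by fun_prop : Differentiable ℂ fun ζ : ℂ => (1 - I) * ζ)).const_mul _

lemma differentiable_blockMatrix {u₁ u₂ v₁ v₂ : ℂ → ℂ} (h1 : Differentiable ℂ u₁)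
    (h2 : Differentiable ℂ u₂) (h3 : Differentiable ℂ v₁) (h4 : Differentiable ℂ v₂) (i j : Fin 3) :
    Differentiable ℂ fun ζ => blockMatrix (u₁ ζ) (u₂ ζ) (v₁ ζ) (v₂ ζ) i j := by
  fin_cases i <;> fin_cases j <;> simp [blockMatrix] <;> assumption

lemma differentiable_solS0 (i j : Fin 3) : Differentiable ℂ fun ζ => solS0 ζ i j :=
  differentiable_blockMatrix differentiable_colA₁ differentiable_colA₂ differentiable_colB₁
    differentiable_colB₂ i j

lemma differentiable_solS1 (i j : Fin 3) : Differentiable ℂ fun ζ => solS1 ζ i j := by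
  have := differentiable_colA₁
  have := differentiable_colA₂
  exact differentiable_blockMatrix (by fun_prop) (by fun_prop) differentiable_colB₁
    differentiable_colB₂ i j

lemma differentiable_solSm1 (i j : Fin 3) : Differentiable ℂ fun ζ => solSm1 ζ i j := by
  have := differentiable_colB₁
  have := differentiable_colB₂
  exact differentiable_blockMatrix differentiable_colA₁ differentiable_colA₂ (by fun_prop)
    (by fun_prop) i j

lemma differentiable_solS2 (i j : Fin 3) : Differentiable ℂ fun ζ => solS2 ζ i j := by
  have := differentiable_colA₁
  have := differentiable_colA₂
  have := differentiable_colB₁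
  have := differentiable_colB₂
  exact differentiable_blockMatrix (by fun_prop) (by fun_prop) (by fun_prop) (by fun_prop) i j

lemma differentiable_solSm2 (i j : Fin 3) : Differentiable ℂ fun ζ => solSm2 ζ i j := by
  have := differentiable_colA₁
  have := differentiable_colA₂
  have := differentiable_colB₁
  have := differentiable_colB₂
  exact differentiable_blockMatrix (by fun_prop) (by fun_prop) (by fun_prop) (by fun_prop) i j

lemma det_blockMatrix (u₁ u₂ v₁ v₂ : ℂ) :
    (blockMatrix u₁ u₂ v₁ v₂).det = u₁ * v₂ - u₂ * v₁ := by
  simp [blockMatrix, Matrix.det_fin_three]; ring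

lemma pcSol_S0 : EqOn pcSol solS0 pcS0 := fun ζ h => by simp [pcSol, h]

lemma pcSol_S1 : EqOn pcSol solS1 pcS1 := fun ζ h => by
  have h' := mem_pcS1_iff.1 h
  have h0 : ζ ∉ pcS0 := fun h => by linarith [(mem_pcS0_iff.1 h).1]
  simp [pcSol, h, h0]

lemma pcSol_Sm1 : EqOn pcSol solSm1 pcSm1 := fun ζ h => by
  have h' := mem_pcSm1_iff.1 h
  have h0 : ζ ∉ pcS0 := fun h => by linarith [(mem_pcS0_iff.1 h).2]
  have h1 : ζ ∉ pcS1 := fun h => by linarith [(mem_pcS1_iff.1 h).1]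
  simp [pcSol, h, h0, h1]

lemma pcSol_S2 : EqOn pcSol solS2 pcS2 := fun ζ h => by
  have h' := mem_pcS2_iff.1 h
  have h0 : ζ ∉ pcS0 := fun h => by linarith [(mem_pcS0_iff.1 h).2]
  have h1 : ζ ∉ pcS1 := fun h => by linarith [(mem_pcS1_iff.1 h).2]
  have h2 : ζ ∉ pcSm1 := fun h => by linarith [(mem_pcSm1_iff.1 h).1]
  simp [pcSol, h, h0, h1, h2]

lemma pcSol_Sm2 : EqOn pcSol solSm2 pcSm2 := fun ζ h => by
  have h' := mem_pcSm2_iff.1 h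
  have h0 : ζ ∉ pcS0 := fun h => by linarith [(mem_pcS0_iff.1 h).2]
  have h1 : ζ ∉ pcS1 := fun h => by linarith [(mem_pcS1_iff.1 h).2]
  have h2 : ζ ∉ pcSm1 := fun h => by linarith [(mem_pcSm1_iff.1 h).1]
  have h3 : ζ ∉ pcS2 := fun h => by linarith [(mem_pcS2_iff.1 h).2.2]
  simp [pcSol, h0, h1, h2, h3]

lemma det_pcSol {ζ : ℂ} (hζ : ζ ∈ pcDomain) : (pcSol ζ).det = 1 := by
  have hA := colA_colB_det ζ
  have hB := colA_colB_det (-ζ)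
  obtain ⟨c1, c2⟩ := connection ζ
  obtain ⟨c3, c4⟩ := connection (-ζ)
  rw [neg_sq, neg_neg] at c3 c4
  have hy := ofReal_pcY_ne_zero
  have hy8 := ofReal_pcY_pow_eight
  rcases mem_pcDomain_iff.1 hζ with h | h | h | h | h
  · rw [pcSol_S0 h, solS0, det_blockMatrix, hA]
  · rw [pcSol_S1 h, solS1, det_blockMatrix]
    generalize cexp (-I * ζ ^ 2) = e at *
    rw [c1, c2] at hA ⊢
    linear_combination hA
  · rw [pcSol_Sm1 h, solSm1, det_blockMatrix]
    generalize cexp (-I * ζ ^ 2) = e at *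
    rw [c1, c2] at hA
    rw [c3, c4]
    linear_combination hA
  · rw [pcSol_S2 h, solS2, det_blockMatrix]
    field_simp
    linear_combination hB
  · rw [pcSol_Sm2 h, solSm2, det_blockMatrix]
    field_simp
    linear_combination hB

lemma tendsto_of_eqOn {U M : ℂ → Matrix (Fin 3) (Fin 3) ℂ} {S : Set ℂ} (h : EqOn U M S)
    (hM : ∀ i j, Differentiable ℂ fun ζ => M ζ i j) (z : ℂ) : Tendsto U (𝓝[S] z) (𝓝 (M z)) := by
  have hc : Continuous M := continuous_pi fun i => continuous_pi fun j => (hM i j).continuous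
  refine (hc.continuousAt.tendsto.mono_left nhdsWithin_le_nhds).congr' ?_
  filter_upwards [self_mem_nhdsWithin] with w hw using (h hw).symm

lemma pcRegularOn_of_eqOn {U M : ℂ → Matrix (Fin 3) (Fin 3) ℂ} {S : Set ℂ} (h : EqOn U M S)
    (hM : ∀ i j, Differentiable ℂ fun ζ => M ζ i j) : pcRegularOn U S :=
  ⟨fun i j => (hM i j).differentiableOn.congr fun ζ hζ => by rw [h hζ],
    fun z _ => ⟨M z, tendsto_of_eqOn h hM z⟩⟩

lemma pcJump_of_eqOn {U Mp Mm V : ℂ → Matrix (Fin 3) (Fin 3) ℂ} {L Sp Sm : Set ℂ}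
    (hp : EqOn U Mp Sp) (hm : EqOn U Mm Sm) (hMp : ∀ i j, Differentiable ℂ fun ζ => Mp ζ i j)
    (hMm : ∀ i j, Differentiable ℂ fun ζ => Mm ζ i j) (h : ∀ ζ, Mp ζ = Mm ζ * V ζ) :
    pcJump U L Sp Sm V := fun z _ =>
  ⟨Mp z, Mm z, tendsto_of_eqOn hp hMp z, tendsto_of_eqOn hm hMm z, h z⟩

lemma blockMatrix_mul (u₁ u₂ v₁ v₂ a b c d : ℂ) :
    blockMatrix u₁ u₂ v₁ v₂ * !![a, b, 0; c, d, 0; 0, 0, 1] =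
      blockMatrix (u₁ * a + v₁ * c) (u₂ * a + v₂ * c) (u₁ * b + v₁ * d) (u₂ * b + v₂ * d) := by
  ext i j
  fin_cases i <;> fin_cases j <;> simp [blockMatrix, Matrix.mul_apply, Fin.sum_univ_three]

lemma cexp_mul_cexp_neg (ζ : ℂ) : cexp (I * ζ ^ 2) * cexp (-I * ζ ^ 2) = 1 := by
  rw [← Complex.exp_add, ← Complex.exp_zero]; congr 1; ring

lemma solS0_eq_solS1_mul (ζ : ℂ) :
    solS0 ζ = solS1 ζ * !![1, 0, 0; -cexp (I * ζ ^ 2), 1, 0; 0, 0, 1] := by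
  obtain ⟨c1, c2⟩ := connection ζ
  have he := cexp_mul_cexp_neg ζ
  rw [solS0, solS1, blockMatrix_mul]
  congr 1
  · rw [c1]; linear_combination (pcY ^ 4 * colA₁ (-ζ) - colA₁ ζ) * he
  · rw [c2]; linear_combination (-(pcY ^ 4 * colA₂ (-ζ)) - colA₂ ζ) * he
  · ring
  · ring

lemma solS1_eq_solS2_mul (ζ : ℂ) :
    solS1 ζ = solS2 ζ * !![1, (1 / 2) * cexp (-(I * ζ ^ 2)), 0; 0, 1, 0; 0, 0, 1] := by
  obtain ⟨c1, c2⟩ := connection ζ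
  obtain ⟨c3, c4⟩ := connection (-ζ)
  have hy := ofReal_pcY_ne_zero
  have hy8 := ofReal_pcY_pow_eight
  rw [neg_sq, neg_neg] at c3 c4
  rw [solS1, solS2, blockMatrix_mul, ← neg_mul I (ζ ^ 2)]
  generalize cexp (-I * ζ ^ 2) = e at *
  congr 1
  · ring
  · ring
  · rw [c1, c3]
    field_simp
    linear_combination (e * colA₁ (-ζ)) * hy8
  · rw [c2, c4]
    field_simp
    linear_combination -(e * colA₂ (-ζ)) * hy8

lemma solS2_eq_solSm2_mul (ζ : ℂ) :
    solS2 ζ = solSm2 ζ * !![2, 0, 0; 0, 1 / 2, 0; 0, 0, 1] := by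
  have hy := ofReal_pcY_ne_zero
  have hy8 := ofReal_pcY_pow_eight
  rw [solS2, solSm2, blockMatrix_mul]
  congr 1
  · field_simp
    linear_combination colA₁ (-ζ) * hy8
  · field_simp
    linear_combination (-colA₂ (-ζ)) * hy8
  · field_simp
    linear_combination colB₁ (-ζ) * hy8
  · field_simp
    linear_combination (-colB₂ (-ζ)) * hy8

lemma solSm1_eq_solSm2_mul (ζ : ℂ) :
    solSm1 ζ = solSm2 ζ * !![1, 0, 0; -((1 / 2) * cexp (I * ζ ^ 2)), 1, 0; 0, 0, 1] := by
  obtain ⟨c3, c4⟩ := connection (-ζ)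
  have he := cexp_mul_cexp_neg ζ
  have hy := ofReal_pcY_ne_zero
  have hy8 := ofReal_pcY_pow_eight
  rw [neg_sq, neg_neg] at c3 c4
  rw [solSm1, solSm2, blockMatrix_mul]
  generalize cexp (-I * ζ ^ 2) = e at *
  generalize cexp (I * ζ ^ 2) = e' at *
  congr 1
  · rw [c3]
    field_simp
    linear_combination (pcY ^ 8 * colA₁ (-ζ) - pcY ^ 12 * colA₁ ζ) * he +
      (colA₁ (-ζ) - pcY ^ 4 * colA₁ ζ) * hy8
  · rw [c4]
    field_simp
    linear_combination (-(pcY ^ 8 * colA₂ (-ζ)) - pcY ^ 12 * colA₂ ζ) * he +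
      (-colA₂ (-ζ) - pcY ^ 4 * colA₂ ζ) * hy8
  · ring
  · ring

lemma solS0_eq_solSm1_mul (ζ : ℂ) :
    solS0 ζ = solSm1 ζ * !![1, cexp (-(I * ζ ^ 2)), 0; 0, 1, 0; 0, 0, 1] := by
  obtain ⟨c1, c2⟩ := connection ζ
  obtain ⟨c3, c4⟩ := connection (-ζ)
  have hy8 := ofReal_pcY_pow_eight
  rw [neg_sq, neg_neg] at c3 c4
  rw [solS0, solSm1, blockMatrix_mul, ← neg_mul I (ζ ^ 2)]
  generalize cexp (-I * ζ ^ 2) = e at *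
  congr 1
  · ring
  · ring
  · rw [c1, c3]
    linear_combination (e * colA₁ ζ) * hy8
  · rw [c2, c4]
    linear_combination (e * colA₂ ζ) * hy8

/-! ### Asymptotics of the solution -/

/-- The logarithm `(ln 2) / 2 + i k π / 4` of the scaling factor `√2 exp (i k π / 4)`. Values of `k`
that differ by `8` give the same factor but different branches of its powers. -/
def logScale (k : ℤ) : ℂ := (Real.log 2 / 2 : ℝ) + (k * (Real.pi / 4) : ℝ) * I

lemma logScale_im (k : ℤ) : (logScale k).im = k * (Real.pi / 4) := by
  simp only [logScale, add_im, ofReal_im, mul_im, ofReal_re, I_im, I_re]; ring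

lemma logScale_re (k : ℤ) : (logScale k).re = Real.log 2 / 2 := by
  simp only [logScale, add_re, ofReal_im, mul_re, ofReal_re, I_im, I_re]; ring

lemma exp_log_two_div_two : Real.exp (Real.log 2 / 2) = Real.sqrt 2 := by
  rw [Real.sqrt_eq_rpow, Real.rpow_def_of_pos two_pos]; ring_nf

lemma cexp_logScale_one : cexp (logScale 1) = 1 + I := by
  have h2 : Real.sqrt 2 * Real.sqrt 2 = 2 := Real.mul_self_sqrt two_pos.le
  apply Complex.ext
  · rw [exp_re, logScale_re, logScale_im, exp_log_two_div_two]
    simp only [Int.cast_one, one_mul, Real.cos_pi_div_four]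
    simp; linarith
  · rw [exp_im, logScale_re, logScale_im, exp_log_two_div_two]
    simp only [Int.cast_one, one_mul, Real.sin_pi_div_four]
    simp; linarith

lemma cexp_logScale_neg_one : cexp (logScale (-1)) = 1 - I := by
  have h2 : Real.sqrt 2 * Real.sqrt 2 = 2 := Real.mul_self_sqrt two_pos.le
  apply Complex.ext
  · rw [exp_re, logScale_re, logScale_im, exp_log_two_div_two]
    simp only [Int.cast_neg, Int.cast_one, neg_mul, one_mul, Real.cos_neg, Real.cos_pi_div_four]
    simp; linarith
  · rw [exp_im, logScale_re, logScale_im, exp_log_two_div_two]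
    simp only [Int.cast_neg, Int.cast_one, neg_mul, one_mul, Real.sin_neg, Real.sin_pi_div_four]
    simp; linarith

lemma cexp_logScale_add_four (k : ℤ) : cexp (logScale (k + 4)) = -cexp (logScale k) := by
  rw [← Complex.exp_add_pi_mul_I, logScale, logScale]
  congr 1
  push_cast
  ring

lemma cexp_logScale_three : cexp (logScale 3) = -(1 - I) := by
  rw [← cexp_logScale_neg_one, ← cexp_logScale_add_four]; norm_num

lemma cexp_logScale_five : cexp (logScale 5) = -(1 + I) := by
  rw [← cexp_logScale_one, ← cexp_logScale_add_four]; norm_num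

lemma cexp_logScale_neg_three : cexp (logScale (-3)) = -(1 + I) := by
  rw [← cexp_logScale_one, show (1 : ℤ) = -3 + 4 by norm_num, cexp_logScale_add_four, neg_neg]

lemma cexp_logScale_neg_five : cexp (logScale (-5)) = -(1 - I) := by
  rw [← cexp_logScale_neg_one, show (-1 : ℤ) = -5 + 4 by norm_num, cexp_logScale_add_four, neg_neg]

lemma cexp_logScale_mul (k : ℤ) :
    cexp (I * (pcP : ℂ) * logScale k) = pcT pcP * (pcY : ℂ) ^ (-k) := by
  have h : I * (pcP : ℂ) * logScale k =
      I * pcP * (Real.log 2 / 2 : ℝ) + ((-k : ℤ) : ℂ) * ((Real.log 2 / 8 : ℝ) : ℂ) := by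
    have h2 : (pcP : ℂ) * (Real.pi : ℂ) = ((Real.log 2 / 2 : ℝ) : ℂ) := by
      rw [← ofReal_mul, mul_comm, pi_mul_pcP]
    rw [logScale]
    push_cast at h2 ⊢
    linear_combination (pcP * k * (Real.pi / 4) : ℂ) * I_sq - (k / 4 : ℂ) * h2
  rw [h, Complex.exp_add, Complex.exp_int_mul, ← ofReal_exp, pcT, pcY]

lemma cexp_logScale_mul_neg (k : ℤ) :
    cexp (I * ((-pcP : ℝ) : ℂ) * logScale k) = pcT (-pcP) * (pcY : ℂ) ^ k := by
  have h : I * ((-pcP : ℝ) : ℂ) * logScale k = -(I * (pcP : ℂ) * logScale k) := by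
    push_cast; ring
  rw [h, Complex.exp_neg, cexp_logScale_mul, pcT_neg, mul_inv, zpow_neg, inv_inv]

section Rotation

variable {ζ : ℂ} (h0 : ζ ≠ 0) {k : ℤ} (hk : |ζ.arg + k * (Real.pi / 4)| ≤ Real.pi / 2)
include h0

lemma cexp_logScale_mul_eq : cexp (logScale k) * ζ = cexp (log ζ + logScale k) := by
  rw [Complex.exp_add, Complex.exp_log h0, mul_comm]

include hk

/-- If rotation by `k π / 4` takes `ζ` to the right half-plane without winding around the origin,
the principal power of the product is the product of the powers. -/
lemma cexp_logScale_mul_cpow (q : ℝ) :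
    (cexp (logScale k) * ζ) ^ (I * (q : ℂ)) = cexp (I * q * logScale k) * ζ ^ (I * (q : ℂ)) := by
  have hp := Real.pi_pos
  rw [abs_le] at hk
  rw [cexp_logScale_mul_eq h0, cpow_def_of_ne_zero (Complex.exp_ne_zero _),
    cpow_def_of_ne_zero h0, log_exp, ← Complex.exp_add]
  · congr 1; ring
  · rw [add_im, log_im, logScale_im]; linarith
  · rw [add_im, log_im, logScale_im]; linarith

lemma cexp_logScale_mul_re_nonneg : 0 ≤ (cexp (logScale k) * ζ).re := by
  rw [abs_le] at hk
  rw [cexp_logScale_mul_eq h0, exp_re, add_im, log_im, logScale_im]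
  exact mul_nonneg (Real.exp_pos _).le (Real.cos_nonneg_of_neg_pi_div_two_le_of_le hk.1 hk.2)

end Rotation

lemma norm_cexp_logScale (k : ℤ) : 1 ≤ ‖cexp (logScale k)‖ := by
  rw [norm_exp, logScale_re, Real.one_le_exp_iff]
  have := Real.log_pos one_lt_two
  positivity

lemma DecaysOnHalfPlane.isBigO {f : ℂ → ℂ} {m : ℕ} (hf : DecaysOnHalfPlane f m) (hm : 2 ≤ m)
    {k : ℤ} {S : Set ℂ}
    (hS : ∀ ζ ∈ S, ζ ≠ 0 ∧ |ζ.arg + k * (Real.pi / 4)| ≤ Real.pi / 2) :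
    (fun ζ => f (cexp (logScale k) * ζ)) =O[Bornology.cobounded ℂ ⊓ 𝓟 S] fun ζ => (ζ ^ 2)⁻¹ := by
  obtain ⟨C, hC, h⟩ := hf
  apply IsBigO.of_bound C
  rw [eventually_inf_principal]
  filter_upwards [tendsto_norm_cobounded_atTop.eventually_ge_atTop 1] with ζ h1 hζ
  obtain ⟨h0, hk⟩ := hS ζ hζ
  have hn : ‖ζ‖ ≤ ‖cexp (logScale k) * ζ‖ := by
    rw [norm_mul]; nlinarith [norm_cexp_logScale k]
  refine (h _ (cexp_logScale_mul_re_nonneg h0 hk) (h1.trans hn)).trans ?_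
  rw [norm_inv, norm_pow, ← div_eq_mul_inv]
  refine div_le_div_of_nonneg_left hC (by positivity) ?_
  calc ‖ζ‖ ^ 2 ≤ ‖ζ‖ ^ m := pow_le_pow_right₀ h1 hm
    _ ≤ _ := pow_le_pow_left₀ (norm_nonneg _) hn m

lemma isBigO_pcF (q : ℝ) {k : ℤ} {S : Set ℂ}
    (hS : ∀ ζ ∈ S, ζ ≠ 0 ∧ |ζ.arg + k * (Real.pi / 4)| ≤ Real.pi / 2) :
    (fun ζ => cexp (I * q * logScale k) * pcF q (cexp (logScale k) * ζ) * ζ ^ (I * (q : ℂ)) - 1)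
      =O[Bornology.cobounded ℂ ⊓ 𝓟 S] fun ζ => (ζ ^ 2)⁻¹ := by
  refine ((pcF_asymptotic q).isBigO le_rfl hS).congr' ?_ EventuallyEq.rfl
  filter_upwards [mem_inf_of_right (mem_principal_self S)] with ζ hζ
  rw [cexp_logScale_mul_cpow (hS ζ hζ).1 (hS ζ hζ).2]
  ring

lemma isBigO_pcH (q : ℝ) {k : ℤ} {S : Set ℂ}
    (hS : ∀ ζ ∈ S, ζ ≠ 0 ∧ |ζ.arg + k * (Real.pi / 4)| ≤ Real.pi / 2) :
    (fun ζ => cexp (I * q * logScale k) * pcH q (cexp (logScale k) * ζ) * ζ ^ (I * (q : ℂ)) -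
      1 / (cexp (logScale k) * ζ)) =O[Bornology.cobounded ℂ ⊓ 𝓟 S] fun ζ => (ζ ^ 2)⁻¹ := by
  refine ((pcH_asymptotic q).isBigO (by norm_num) hS).congr' ?_ EventuallyEq.rfl
  filter_upwards [mem_inf_of_right (mem_principal_self S)] with ζ hζ
  rw [cexp_logScale_mul_cpow (hS ζ hζ).1 (hS ζ hζ).2]
  ring

/-- The expansion of `HasPCExpansion` along the subset `S` of the domain. -/
def HasExpansionOn (U : ℂ → Matrix (Fin 3) (Fin 3) ℂ) (S : Set ℂ) : Prop :=
  ∀ i j : Fin 3, (fun ζ : ℂ => (U ζ * pcDiag ζ - 1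
      - (1 / (2 * I * ζ)) • (!![0, pcr, 0; -pcs, 0, 0; 0, 0, 0] : Matrix (Fin 3) (Fin 3) ℂ)) i j)
    =O[Bornology.cobounded ℂ ⊓ 𝓟 S] (fun ζ : ℂ => (ζ ^ 2)⁻¹)

/-- The expansion read off from the four nontrivial entries, with the coefficients of `1 / ζ`
written through `pcMu`. -/
lemma hasExpansionOn_blockMatrix {u₁ u₂ v₁ v₂ : ℂ → ℂ} {S : Set ℂ}
    (h1 : (fun ζ => u₁ ζ * ζ ^ (I * (pcP : ℂ)) - 1)
      =O[Bornology.cobounded ℂ ⊓ 𝓟 S] fun ζ => (ζ ^ 2)⁻¹)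
    (h2 : (fun ζ => u₂ ζ * ζ ^ (I * (pcP : ℂ)) - pcMu (-pcP) / ((1 + I) * ζ))
      =O[Bornology.cobounded ℂ ⊓ 𝓟 S] fun ζ => (ζ ^ 2)⁻¹)
    (h3 : (fun ζ => v₁ ζ * ζ ^ (I * ((-pcP : ℝ) : ℂ)) - pcMu pcP / ((1 - I) * ζ))
      =O[Bornology.cobounded ℂ ⊓ 𝓟 S] fun ζ => (ζ ^ 2)⁻¹)
    (h4 : (fun ζ => v₂ ζ * ζ ^ (I * ((-pcP : ℝ) : ℂ)) - 1)
      =O[Bornology.cobounded ℂ ⊓ 𝓟 S] fun ζ => (ζ ^ 2)⁻¹) :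
    HasExpansionOn (fun ζ => blockMatrix (u₁ ζ) (u₂ ζ) (v₁ ζ) (v₂ ζ)) S := by
  have ha := one_add_I_ne_zero
  have hb := one_sub_I_ne_zero
  have hneg : -(I * (pcP : ℂ)) = I * ((-pcP : ℝ) : ℂ) := by push_cast; ring
  have e2 : ∀ ζ : ℂ, pcMu (-pcP) / ((1 + I) * ζ) = (1 / (2 * I * ζ)) * (-pcs) := by
    intro ζ
    rcases eq_or_ne ζ 0 with rfl | hζ
    · simp
    · rw [pcs]
      have := I_ne_zero
      field_simp
      linear_combination (-pcMu (-pcP)) * I_sq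
  have e3 : ∀ ζ : ℂ, pcMu pcP / ((1 - I) * ζ) = (1 / (2 * I * ζ)) * pcr := by
    intro ζ
    rcases eq_or_ne ζ 0 with rfl | hζ
    · simp
    · rw [pcr]
      have := I_ne_zero
      field_simp
      linear_combination pcMu pcP * I_sq
  simp only [e2] at h2
  simp only [e3] at h3
  have hz : (fun _ : ℂ => (0 : ℂ)) =O[Bornology.cobounded ℂ ⊓ 𝓟 S] fun ζ : ℂ => (ζ ^ 2)⁻¹ :=
    isBigO_zero _ _
  have hD : ∀ ζ : ℂ, pcDiag ζ = !![ζ ^ (I * (pcP : ℂ)), 0, 0;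
      0, ζ ^ (I * ((-pcP : ℝ) : ℂ)), 0; 0, 0, 1] := by
    intro ζ
    rw [pcDiag, hneg]
    ext i j
    fin_cases i <;> fin_cases j <;> rfl
  intro i j
  simp only [hD, blockMatrix_mul, mul_zero, zero_add, add_zero]
  fin_cases i <;> fin_cases j <;> simp [blockMatrix] <;> first | exact hz | skip
  · exact h1
  · simpa using h3
  · simpa using h2
  · simpa using h4

lemma HasExpansionOn.congr {U V : ℂ → Matrix (Fin 3) (Fin 3) ℂ} {S : Set ℂ}
    (h : HasExpansionOn V S) (hUV : EqOn U V S) : HasExpansionOn U S := fun i j => by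
  refine (h i j).congr' ?_ EventuallyEq.rfl
  filter_upwards [mem_inf_of_right (mem_principal_self S)] with ζ hζ
  rw [hUV hζ]

lemma HasExpansionOn.union {U : ℂ → Matrix (Fin 3) (Fin 3) ℂ} {S S' : Set ℂ}
    (h : HasExpansionOn U S) (h' : HasExpansionOn U S') : HasExpansionOn U (S ∪ S') := fun i j => by
  rw [← sup_principal, inf_sup_left]
  exact (h i j).sup (h' i j)

lemma isBigO_colA {S : Set ℂ}
    (hS : ∀ ζ ∈ S, ζ ≠ 0 ∧ |ζ.arg + (1 : ℤ) * (Real.pi / 4)| ≤ Real.pi / 2) :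
    ((fun ζ => colA₁ ζ * ζ ^ (I * (pcP : ℂ)) - 1)
      =O[Bornology.cobounded ℂ ⊓ 𝓟 S] fun ζ => (ζ ^ 2)⁻¹) ∧
    ((fun ζ => colA₂ ζ * ζ ^ (I * (pcP : ℂ)) - pcMu (-pcP) / ((1 + I) * ζ))
      =O[Bornology.cobounded ℂ ⊓ 𝓟 S] fun ζ => (ζ ^ 2)⁻¹) := by
  have hF := isBigO_pcF pcP hS
  have hH := (isBigO_pcH pcP hS).const_mul_left (pcMu (-pcP))
  rw [cexp_logScale_mul, cexp_logScale_one, zpow_neg_one] at hF hH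
  refine ⟨hF.congr_left fun ζ => ?_, hH.congr_left fun ζ => ?_⟩
  · rw [colA₁]; ring
  · rw [colA₂]; ring

/-- The asymptotics of the reflected first column; the two branches `k = -3` (above the negative
axis) and `k = 5` (below it) give the constants `pcY ^ 4` and `pcY ^ (-4)`. -/
lemma isBigO_colA_neg {k : ℤ} (hk : cexp (logScale k) = -(1 + I)) {S : Set ℂ}
    (hS : ∀ ζ ∈ S, ζ ≠ 0 ∧ |ζ.arg + k * (Real.pi / 4)| ≤ Real.pi / 2) :
    ((fun ζ => (pcY : ℂ) ^ (1 - k) * colA₁ (-ζ) * ζ ^ (I * (pcP : ℂ)) - 1)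
      =O[Bornology.cobounded ℂ ⊓ 𝓟 S] fun ζ => (ζ ^ 2)⁻¹) ∧
    ((fun ζ => -((pcY : ℂ) ^ (1 - k) * colA₂ (-ζ)) * ζ ^ (I * (pcP : ℂ)) -
        pcMu (-pcP) / ((1 + I) * ζ))
      =O[Bornology.cobounded ℂ ⊓ 𝓟 S] fun ζ => (ζ ^ 2)⁻¹) := by
  have hy := ofReal_pcY_ne_zero
  have hz : (pcY : ℂ) ^ (1 - k) = pcY * (pcY : ℂ) ^ (-k) := by
    rw [sub_eq_add_neg, zpow_add₀ hy, zpow_one]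
  have hF := isBigO_pcF pcP hS
  have hH := (isBigO_pcH pcP hS).const_mul_left (-pcMu (-pcP))
  rw [cexp_logScale_mul, hk] at hF hH
  refine ⟨hF.congr_left fun ζ => ?_, hH.congr_left fun ζ => ?_⟩
  · rw [colA₁, hz, mul_neg, neg_mul (1 + I) ζ]
    field_simp
  · rw [colA₂, hz, mul_neg, neg_mul (1 + I) ζ, div_neg]
    field_simp
    ring

lemma isBigO_colB {S : Set ℂ}
    (hS : ∀ ζ ∈ S, ζ ≠ 0 ∧ |ζ.arg + (-1 : ℤ) * (Real.pi / 4)| ≤ Real.pi / 2) :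
    ((fun ζ => colB₁ ζ * ζ ^ (I * ((-pcP : ℝ) : ℂ)) - pcMu pcP / ((1 - I) * ζ))
      =O[Bornology.cobounded ℂ ⊓ 𝓟 S] fun ζ => (ζ ^ 2)⁻¹) ∧
    ((fun ζ => colB₂ ζ * ζ ^ (I * ((-pcP : ℝ) : ℂ)) - 1)
      =O[Bornology.cobounded ℂ ⊓ 𝓟 S] fun ζ => (ζ ^ 2)⁻¹) := by
  have hF := isBigO_pcF (-pcP) hS
  have hH := (isBigO_pcH (-pcP) hS).const_mul_left (pcMu pcP)
  rw [cexp_logScale_mul_neg, cexp_logScale_neg_one, zpow_neg_one] at hF hH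
  refine ⟨hH.congr_left fun ζ => ?_, hF.congr_left fun ζ => ?_⟩
  · rw [colB₁]; ring
  · rw [colB₂]; ring

/-- The asymptotics of the reflected second column; the two branches `k = -5` (above the negative
axis) and `k = 3` (below it) give the constants `pcY ^ (-4)` and `pcY ^ 4`. -/
lemma isBigO_colB_neg {k : ℤ} (hk : cexp (logScale k) = -(1 - I)) {S : Set ℂ}
    (hS : ∀ ζ ∈ S, ζ ≠ 0 ∧ |ζ.arg + k * (Real.pi / 4)| ≤ Real.pi / 2) :
    ((fun ζ => -((pcY : ℂ) ^ (1 + k) * colB₁ (-ζ)) * ζ ^ (I * ((-pcP : ℝ) : ℂ)) -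
        pcMu pcP / ((1 - I) * ζ))
      =O[Bornology.cobounded ℂ ⊓ 𝓟 S] fun ζ => (ζ ^ 2)⁻¹) ∧
    ((fun ζ => (pcY : ℂ) ^ (1 + k) * colB₂ (-ζ) * ζ ^ (I * ((-pcP : ℝ) : ℂ)) - 1)
      =O[Bornology.cobounded ℂ ⊓ 𝓟 S] fun ζ => (ζ ^ 2)⁻¹) := by
  have hy := ofReal_pcY_ne_zero
  have hz : (pcY : ℂ) ^ (1 + k) = pcY * (pcY : ℂ) ^ k := by
    rw [zpow_add₀ hy, zpow_one]
  have hF := isBigO_pcF (-pcP) hS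
  have hH := (isBigO_pcH (-pcP) hS).const_mul_left (-pcMu pcP)
  rw [cexp_logScale_mul_neg, hk] at hF hH
  refine ⟨hH.congr_left fun ζ => ?_, hF.congr_left fun ζ => ?_⟩
  · rw [colB₁, hz, mul_neg, neg_mul (1 - I) ζ, div_neg]
    field_simp
    ring
  · rw [colB₂, hz, mul_neg, neg_mul (1 - I) ζ]
    field_simp

lemma zpow_four_eq (y : ℂ) : y ^ (4 : ℤ) = y ^ 4 := by norm_cast

lemma zpow_neg_four_mul (y x : ℂ) : y ^ (-4 : ℤ) * x = x / y ^ 4 := by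
  rw [zpow_neg, zpow_four_eq, mul_comm, div_eq_mul_inv]

/-- In each sector the rotation index `k` is the one for which `arg ζ + k π / 4` lies in
`[-π / 2, π / 2]`. -/
lemma hasExpansionOn_pcSol : HasExpansionOn pcSol pcDomain := by
  have hp := Real.pi_pos
  refine ((((HasExpansionOn.congr ?_ pcSol_S0).union (HasExpansionOn.congr ?_ pcSol_S1)).union
    (HasExpansionOn.congr ?_ pcSol_Sm1)).union (HasExpansionOn.congr ?_ pcSol_S2)).union
    (HasExpansionOn.congr ?_ pcSol_Sm2)
  · have hA := isBigO_colA (S := pcS0) fun ζ hζ => ⟨hζ.1, by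
      have := hζ.2.1; have := hζ.2.2
      rw [abs_le]; push_cast; constructor <;> linarith⟩
    have hB := isBigO_colB (S := pcS0) fun ζ hζ => ⟨hζ.1, by
      have := hζ.2.1; have := hζ.2.2
      rw [abs_le]; push_cast; constructor <;> linarith⟩
    exact hasExpansionOn_blockMatrix hA.1 hA.2 hB.1 hB.2
  · have hA := isBigO_colA_neg (S := pcS1) cexp_logScale_neg_three fun ζ hζ => ⟨hζ.1, by
      have := hζ.2.1; have := hζ.2.2
      rw [abs_le]; push_cast; constructor <;> linarith⟩
    have hB := isBigO_colB (S := pcS1) fun ζ hζ => ⟨hζ.1, by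
      have := hζ.2.1; have := hζ.2.2
      rw [abs_le]; push_cast; constructor <;> linarith⟩
    norm_num only [zpow_four_eq] at hA
    exact hasExpansionOn_blockMatrix hA.1 hA.2 hB.1 hB.2
  · have hA := isBigO_colA (S := pcSm1) fun ζ hζ => ⟨hζ.1, by
      have := hζ.2.1; have := hζ.2.2
      rw [abs_le]; push_cast; constructor <;> linarith⟩
    have hB := isBigO_colB_neg (S := pcSm1) cexp_logScale_three fun ζ hζ => ⟨hζ.1, by
      have := hζ.2.1; have := hζ.2.2
      rw [abs_le]; push_cast; constructor <;> linarith⟩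
    norm_num only [zpow_four_eq] at hB
    exact hasExpansionOn_blockMatrix hA.1 hA.2 hB.1 hB.2
  · have hA := isBigO_colA_neg (S := pcS2) cexp_logScale_neg_three fun ζ hζ => ⟨hζ.1, by
      have := hζ.2.1; have := hζ.2.2
      rw [abs_le]; push_cast; constructor <;> linarith⟩
    have hB := isBigO_colB_neg (S := pcS2) cexp_logScale_neg_five fun ζ hζ => ⟨hζ.1, by
      have := hζ.2.1; have := hζ.2.2
      rw [abs_le]; push_cast; constructor <;> linarith⟩
    norm_num only [zpow_four_eq] at hA
    norm_num only [zpow_neg_four_mul] at hB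
    exact hasExpansionOn_blockMatrix hA.1 hA.2 hB.1 hB.2
  · have hA := isBigO_colA_neg (S := pcSm2) cexp_logScale_five fun ζ hζ => ⟨hζ.1, by
      have := hζ.2.1; have := hζ.2.2
      rw [abs_le]; push_cast; constructor <;> linarith⟩
    have hB := isBigO_colB_neg (S := pcSm2) cexp_logScale_three fun ζ hζ => ⟨hζ.1, by
      have := hζ.2.1; have := hζ.2.2
      rw [abs_le]; push_cast; constructor <;> linarith⟩
    norm_num only [zpow_neg_four_mul] at hA
    norm_num only [zpow_four_eq] at hB
    exact hasExpansionOn_blockMatrix hA.1 hA.2 hB.1 hB.2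

lemma tendsto_of_hasPCExpansion {U : ℂ → Matrix (Fin 3) (Fin 3) ℂ} {r s : ℂ}
    (h : HasPCExpansion U r s) : Tendsto (fun ζ => U ζ * pcDiag ζ)
      (Bornology.cobounded ℂ ⊓ 𝓟 pcDomain) (𝓝 1) := by
  have hinv : Tendsto (fun ζ : ℂ => ζ⁻¹) (Bornology.cobounded ℂ ⊓ 𝓟 pcDomain) (𝓝 0) :=
    tendsto_inv₀_cobounded.mono_left inf_le_left
  refine tendsto_pi_nhds.2 fun i => tendsto_pi_nhds.2 fun j => ?_
  have h2 : Tendsto (fun ζ : ℂ => (ζ ^ 2)⁻¹) (Bornology.cobounded ℂ ⊓ 𝓟 pcDomain) (𝓝 0) := by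
    simpa using hinv.pow 2
  have h3 := (h i j).trans_tendsto h2
  set R : Matrix (Fin 3) (Fin 3) ℂ := !![0, r, 0; -s, 0, 0; 0, 0, 0]
  have h4 : Tendsto (fun ζ : ℂ => 1 / (2 * I * ζ) * R i j)
      (Bornology.cobounded ℂ ⊓ 𝓟 pcDomain) (𝓝 0) := by
    have := (hinv.const_mul (1 / (2 * I))).mul_const (R i j)
    simp only [mul_zero, zero_mul] at this
    refine this.congr fun ζ => ?_
    rw [one_div_mul_eq_div, one_div, mul_inv, div_eq_mul_inv]; ring
  have h5 := (h3.add h4).add_const ((1 : Matrix (Fin 3) (Fin 3) ℂ) i j)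
  simp only [zero_add] at h5
  refine h5.congr fun ζ => ?_
  simp only [Matrix.sub_apply, Matrix.smul_apply, smul_eq_mul]
  ring

lemma hasPCExpansion_pcSol : HasPCExpansion pcSol pcr pcs := hasExpansionOn_pcSol

lemma isPCSolution_pcSol : IsPCSolution pcSol where
  regular_S0 := pcRegularOn_of_eqOn pcSol_S0 differentiable_solS0
  regular_S1 := pcRegularOn_of_eqOn pcSol_S1 differentiable_solS1
  regular_Sm1 := pcRegularOn_of_eqOn pcSol_Sm1 differentiable_solSm1
  regular_S2 := pcRegularOn_of_eqOn pcSol_S2 differentiable_solS2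
  regular_Sm2 := pcRegularOn_of_eqOn pcSol_Sm2 differentiable_solSm2
  jump_1 := pcJump_of_eqOn pcSol_S0 pcSol_S1 differentiable_solS0 differentiable_solS1
    solS0_eq_solS1_mul
  jump_2 := pcJump_of_eqOn pcSol_S1 pcSol_S2 differentiable_solS1 differentiable_solS2
    solS1_eq_solS2_mul
  jump_3 := pcJump_of_eqOn pcSol_S2 pcSol_Sm2 differentiable_solS2 differentiable_solSm2
    solS2_eq_solSm2_mul
  jump_4 := pcJump_of_eqOn pcSol_Sm1 pcSol_Sm2 differentiable_solSm1 differentiable_solSm2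
    solSm1_eq_solSm2_mul
  jump_5 := pcJump_of_eqOn pcSol_S0 pcSol_Sm1 differentiable_solS0 differentiable_solSm1
    solS0_eq_solSm1_mul
  normalization := tendsto_of_hasPCExpansion hasPCExpansion_pcSol

/-! ### Uniqueness -/

/-- Equal jumps of determinant `1` cancel in the quotient of two solutions. -/
lemma exists_limit_mul_adjugate {U W V : ℂ → Matrix (Fin 3) (Fin 3) ℂ} {L Sp Sm : Set ℂ}
    (hU : pcJump U L Sp Sm V) (hW : pcJump W L Sp Sm V) (hV : ∀ z, (V z).det = 1) (i j : Fin 3) :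
    ∀ z ∈ L, ∃ y, Tendsto (fun ζ => (U ζ * (W ζ).adjugate) i j) (𝓝[Sp] z ⊔ 𝓝[Sm] z) (𝓝 y) := by
  intro z hz
  obtain ⟨Up, Um, h1, h2, h3⟩ := hU z hz
  obtain ⟨Wp, Wm, k1, k2, k3⟩ := hW z hz
  have hadj : Continuous fun A : Matrix (Fin 3) (Fin 3) ℂ => A.adjugate :=
    continuous_id.matrix_adjugate
  have hent : Continuous fun A : Matrix (Fin 3) (Fin 3) ℂ => A i j :=
    (continuous_apply j).comp (continuous_apply i)
  have e : Up * Wp.adjugate = Um * Wm.adjugate := by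
    rw [h3, k3, Matrix.adjugate_mul_distrib, Matrix.mul_assoc, ← Matrix.mul_assoc (V z),
      Matrix.mul_adjugate, hV, one_smul, Matrix.one_mul]
  refine ⟨(Um * Wm.adjugate) i j, Tendsto.sup ?_ ?_⟩
  · rw [← e]
    exact (hent.tendsto _).comp (h1.mul ((hadj.tendsto _).comp k1))
  · exact (hent.tendsto _).comp (h2.mul ((hadj.tendsto _).comp k2))

lemma differentiableOn_mul_adjugate {U W : ℂ → Matrix (Fin 3) (Fin 3) ℂ} {S : Set ℂ}
    (hU : ∀ i j, DifferentiableOn ℂ (fun ζ => U ζ i j) S)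
    (hW : ∀ i j, DifferentiableOn ℂ (fun ζ => W ζ i j) S) (i j : Fin 3) :
    DifferentiableOn ℂ (fun ζ => (U ζ * (W ζ).adjugate) i j) S := by
  have hadj : ∀ i j, DifferentiableOn ℂ (fun ζ => (W ζ).adjugate i j) S := by
    intro i j
    simp only [Matrix.adjugate_fin_three]
    fin_cases i <;> fin_cases j <;> simp <;> fun_prop
  simp only [Matrix.mul_apply]
  exact DifferentiableOn.fun_sum fun k _ => (hU i k).mul (hadj k j)

lemma exists_bound_mul_adjugate {U W : ℂ → Matrix (Fin 3) (Fin 3) ℂ} {S : Set ℂ}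
    (hU : pcRegularOn U S) (hW : pcRegularOn W S) (i j : Fin 3) :
    ∃ C : ℝ, ∀ᶠ ζ in 𝓝[S] 0, ‖(U ζ * (W ζ).adjugate) i j‖ ≤ C := by
  by_cases h : (0 : ℂ) ∈ closure S
  · obtain ⟨A, hA⟩ := hU.2 0 h
    obtain ⟨B, hB⟩ := hW.2 0 h
    have hadj : Continuous fun A : Matrix (Fin 3) (Fin 3) ℂ => A.adjugate :=
      continuous_id.matrix_adjugate
    have hent : Continuous fun A : Matrix (Fin 3) (Fin 3) ℂ => A i j :=
      (continuous_apply j).comp (continuous_apply i)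
    have ht := ((hent.tendsto _).comp (hA.mul ((hadj.tendsto _).comp hB))).norm
    exact ⟨_, (ht.eventually (Iic_mem_nhds (lt_add_one _))).mono fun ζ hζ => hζ⟩
  · refine ⟨0, ?_⟩
    rw [notMem_closure_iff_nhdsWithin_eq_bot.1 h]
    exact eventually_bot

lemma ne_zero_of_mem_pcDomain {ζ : ℂ} (hζ : ζ ∈ pcDomain) : ζ ≠ 0 := by
  rcases mem_pcDomain_iff.1 hζ with h | h | h | h | h <;> exact h.1

lemma det_pcDiag {ζ : ℂ} (h0 : ζ ≠ 0) : (pcDiag ζ).det = 1 := by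
  rw [pcDiag, Matrix.det_diagonal, Fin.prod_univ_three]
  simp only [Matrix.cons_val_zero, Matrix.cons_val_one, Matrix.cons_val_two, Matrix.head_cons,
    Matrix.tail_cons, mul_one]
  rw [← cpow_add _ _ h0, add_neg_cancel, cpow_zero]

/-- Two solutions differ by a left factor without jumps, which Liouville's theorem shows to be
constant. -/
lemma _root_.IsPCSolution.eqOn_pcSol {U : ℂ → Matrix (Fin 3) (Fin 3) ℂ} (h : IsPCSolution U) :
    EqOn U pcSol pcDomain := by
  have hW := isPCSolution_pcSol
  have hE : ∀ i j, ∀ ζ ∈ pcDomain,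
      (U ζ * (pcSol ζ).adjugate) i j = (1 : Matrix (Fin 3) (Fin 3) ℂ) i j := by
    intro i j
    have hd : DifferentiableOn ℂ (fun ζ => (U ζ * (pcSol ζ).adjugate) i j) pcDomain :=
      ((((differentiableOn_mul_adjugate h.regular_S0.1 hW.regular_S0.1 i j).union_of_isOpen
        (differentiableOn_mul_adjugate h.regular_S1.1 hW.regular_S1.1 i j)
          isOpen_pcS0 isOpen_pcS1).union_of_isOpen
        (differentiableOn_mul_adjugate h.regular_Sm1.1 hW.regular_Sm1.1 i j)
          (isOpen_pcS0.union isOpen_pcS1) isOpen_pcSm1).union_of_isOpen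
        (differentiableOn_mul_adjugate h.regular_S2.1 hW.regular_S2.1 i j)
          ((isOpen_pcS0.union isOpen_pcS1).union isOpen_pcSm1) isOpen_pcS2).union_of_isOpen
        (differentiableOn_mul_adjugate h.regular_Sm2.1 hW.regular_Sm2.1 i j)
          (((isOpen_pcS0.union isOpen_pcS1).union isOpen_pcSm1).union isOpen_pcS2) isOpen_pcSm2
    refine eq_of_no_jumps hd ?_ ?_ ?_
    · exact fun z hz => exists_limit_pcDomain hd
        (exists_limit_mul_adjugate h.jump_1 hW.jump_1 (fun z => by simp [Matrix.det_fin_three]) i j)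
        (exists_limit_mul_adjugate h.jump_2 hW.jump_2 (fun z => by simp [Matrix.det_fin_three]) i j)
        (exists_limit_mul_adjugate h.jump_3 hW.jump_3 (fun z => by simp [Matrix.det_fin_three]) i j)
        (exists_limit_mul_adjugate h.jump_4 hW.jump_4 (fun z => by simp [Matrix.det_fin_three]) i j)
        (exists_limit_mul_adjugate h.jump_5 hW.jump_5 (fun z => by simp [Matrix.det_fin_three]) i j)
        hz
    · obtain ⟨C0, h0⟩ := exists_bound_mul_adjugate h.regular_S0 hW.regular_S0 i j
      obtain ⟨C1, h1⟩ := exists_bound_mul_adjugate h.regular_S1 hW.regular_S1 i j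
      obtain ⟨C2, h2⟩ := exists_bound_mul_adjugate h.regular_Sm1 hW.regular_Sm1 i j
      obtain ⟨C3, h3⟩ := exists_bound_mul_adjugate h.regular_S2 hW.regular_S2 i j
      obtain ⟨C4, h4⟩ := exists_bound_mul_adjugate h.regular_Sm2 hW.regular_Sm2 i j
      refine ⟨max (max (max (max C0 C1) C2) C3) C4, ?_⟩
      simp only [pcDomain, nhdsWithin_union, eventually_sup, le_max_iff]
      exact ⟨⟨⟨⟨h0.mono fun _ => by tauto, h1.mono fun _ => by tauto⟩,
        h2.mono fun _ => by tauto⟩, h3.mono fun _ => by tauto⟩, h4.mono fun _ => by tauto⟩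
    · have hadj : Continuous fun A : Matrix (Fin 3) (Fin 3) ℂ => A.adjugate :=
        continuous_id.matrix_adjugate
      have hent : Continuous fun A : Matrix (Fin 3) (Fin 3) ℂ => A i j :=
        (continuous_apply j).comp (continuous_apply i)
      have ht := (hent.tendsto _).comp
        (h.normalization.mul ((hadj.tendsto _).comp hW.normalization))
      rw [Matrix.adjugate_one, Matrix.mul_one] at ht
      refine ht.congr' ?_
      filter_upwards [mem_inf_of_right (mem_principal_self pcDomain)] with ζ hζ
      simp only [Function.comp]
      rw [Matrix.adjugate_mul_distrib, Matrix.mul_assoc, ← Matrix.mul_assoc (pcDiag ζ),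
        Matrix.mul_adjugate, det_pcDiag (ne_zero_of_mem_pcDomain hζ), one_smul, Matrix.one_mul]
  intro ζ hζ
  have h1 : U ζ * (pcSol ζ).adjugate = 1 := by
    ext i j
    exact hE i j ζ hζ
  calc U ζ = U ζ * (pcSol ζ).adjugate * pcSol ζ := by
        rw [Matrix.mul_assoc, Matrix.adjugate_mul, det_pcSol hζ, one_smul, Matrix.mul_one]
    _ = pcSol ζ := by rw [h1, Matrix.one_mul]

/-! ### The coefficients of the expansion -/

lemma neBot_cobounded_pcDomain : (Bornology.cobounded ℂ ⊓ 𝓟 pcDomain).NeBot := by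
  have h : Tendsto (fun x : ℝ => (x : ℂ)) atTop (Bornology.cobounded ℂ ⊓ 𝓟 pcDomain) := by
    refine tendsto_inf.2 ⟨RCLike.tendsto_ofReal_atTop_cobounded ℂ, tendsto_principal.2 ?_⟩
    filter_upwards [eventually_gt_atTop 0] with x hx
    exact mem_pcDomain_iff.2 (Or.inl (mem_pcS0_iff.2 ⟨by simpa using hx, by simpa using hx⟩))
  exact h.neBot

lemma eq_zero_of_isBigO {c : ℂ}
    (h : (fun ζ : ℂ => 1 / (2 * I * ζ) * c) =O[Bornology.cobounded ℂ ⊓ 𝓟 pcDomain]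
      fun ζ : ℂ => (ζ ^ 2)⁻¹) : c = 0 := by
  have := neBot_cobounded_pcDomain
  have h1 := (isBigO_refl (fun ζ : ℂ => 2 * I * ζ) (Bornology.cobounded ℂ ⊓ 𝓟 pcDomain)).mul h
  have hinv : Tendsto (fun ζ : ℂ => 2 * I * ζ * (ζ ^ 2)⁻¹) (Bornology.cobounded ℂ ⊓ 𝓟 pcDomain)
      (𝓝 0) := by
    have h2 := ((tendsto_inv₀_cobounded (α := ℂ)).mono_left
      (inf_le_left : Bornology.cobounded ℂ ⊓ 𝓟 pcDomain ≤ _)).const_mul (2 * I)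
    rw [mul_zero] at h2
    refine h2.congr fun ζ => ?_
    rcases eq_or_ne ζ 0 with rfl | h
    · simp
    · field_simp
  have h2 := h1.trans_tendsto hinv
  refine tendsto_nhds_unique (tendsto_const_nhds.congr' ?_) h2
  filter_upwards [mem_inf_of_right (mem_principal_self pcDomain)] with ζ hζ
  have h0 := ne_zero_of_mem_pcDomain hζ
  have := I_ne_zero
  field_simp

lemma _root_.HasPCExpansion.unique {U : ℂ → Matrix (Fin 3) (Fin 3) ℂ} {r s r' s' : ℂ}
    (h : HasPCExpansion U r s) (h' : HasPCExpansion U r' s') : r' = r ∧ s' = s := by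
  have e1 := (h 0 1).sub (h' 0 1)
  have e2 := (h 1 0).sub (h' 1 0)
  constructor
  · rw [← sub_eq_zero]
    apply eq_zero_of_isBigO
    refine e1.congr_left fun ζ => ?_
    simp
    ring
  · rw [← sub_eq_zero, ← neg_eq_zero]
    apply eq_zero_of_isBigO
    refine e2.congr_left fun ζ => ?_
    simp
    ring

lemma hasPCExpansion_congr {U V : ℂ → Matrix (Fin 3) (Fin 3) ℂ} {r s : ℂ}
    (h : HasPCExpansion V r s) (hUV : EqOn U V pcDomain) : HasPCExpansion U r s := fun i j => by
  refine (h i j).congr' ?_ EventuallyEq.rfl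
  filter_upwards [mem_inf_of_right (mem_principal_self pcDomain)] with ζ hζ
  rw [hUV hζ]

lemma conj_pcMu_neg (q : ℝ) : starRingEnd ℂ (pcMu (-q)) = -pcMu q := by
  have hG : starRingEnd ℂ (Gamma (1 + I * ((-q : ℝ) : ℂ))) = Gamma (1 + I * q) := by
    rw [← Gamma_conj]; simp
  have hT : starRingEnd ℂ (pcT (-q)) = pcT q := by
    rw [pcT, pcT, ← exp_conj]
    simp only [map_mul, conj_I, conj_ofReal]
    push_cast; ring_nf
  rw [pcMu, map_div₀, hG, map_mul, map_mul, map_mul, map_pow, map_pow, hT]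
  simp only [conj_ofReal]
  rw [pcMu]
  push_cast
  ring

lemma pcr_eq_neg_conj_pcs : pcr = -(starRingEnd ℂ pcs) := by
  rw [pcr, pcs, map_neg, map_mul, conj_pcMu_neg, map_add, map_one, conj_I]
  ring

lemma two_rpow_five_div_four : (2 : ℝ) ^ (5 / 4 : ℝ) = pcY ^ 10 := by
  rw [Real.rpow_def_of_pos two_pos, pcY, ← Real.exp_nat_mul]
  push_cast; ring_nf

lemma pcr_eq_pcR : pcr = pcR := by
  have hp := ofReal_ne_zero.2 pcP_pos.ne'
  have hIp : I * (pcP : ℂ) ≠ 0 := mul_ne_zero I_ne_zero hp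
  have hΓ := Gamma_one_add_I_mul_ne_zero pcP
  have hy := ofReal_pcY_ne_zero
  have hG : Gamma (1 + I * (pcP : ℂ)) = I * pcP * Gamma (I * pcP) := by
    rw [add_comm, Gamma_add_one _ hIp]
  have hG0 : Gamma (I * (pcP : ℂ)) ≠ 0 := fun h => hΓ (by rw [hG, h, mul_zero])
  have hT : cexp (I * ((Real.log 2 ^ 2 / (2 * Real.pi) : ℝ) : ℂ)) = pcT pcP ^ 2 := by
    rw [pcT, ← Complex.exp_nat_mul, pcP]
    congr 1
    push_cast
    have : (Real.pi : ℂ) ≠ 0 := ofReal_ne_zero.2 Real.pi_ne_zero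
    field_simp
  have hY : cexp (I * ((Real.pi / 4 : ℝ) : ℂ)) * pcY ^ 4 = 1 + I := by
    rw [← cexp_logScale_one, logScale, Complex.exp_add, pcY, ← ofReal_pow, ← Real.exp_nat_mul,
      ofReal_exp, mul_comm]
    congr 1
    · congr 1; push_cast; ring
    · congr 1; push_cast; ring
  have hR : pcR = ((pcY ^ 10 : ℝ) : ℂ) * cexp (I * ((Real.log 2 ^ 2 / (2 * Real.pi) : ℝ) : ℂ))
      * ((Real.sqrt Real.pi : ℝ) : ℂ) * cexp (I * ((Real.pi / 4 : ℝ) : ℂ)) /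
        Gamma (I * (pcP : ℂ)) := by
    rw [pcR, two_rpow_five_div_four]; rfl
  rw [hR, hT, pcr, pcMu, hG]
  generalize cexp (I * ((Real.pi / 4 : ℝ) : ℂ)) = e at *
  have hI := I_ne_zero
  generalize Gamma (I * (pcP : ℂ)) = g at *
  push_cast
  field_simp
  linear_combination (-I * pcT pcP ^ 2) * hY - pcT pcP ^ 2 * I_sq

lemma norm_pcR : ‖pcR‖ = Real.sqrt (Real.log 2 / Real.pi) := by
  have h : pcr * pcs = -2 * (pcP : ℂ) := by
    rw [pcr, pcs]
    linear_combination (1 - I) * (1 + I) * pcMu_mul_pcMu_neg + (pcP : ℂ) * I_sq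
  have hs : ‖pcs‖ = ‖pcr‖ := by rw [pcr_eq_neg_conj_pcs, norm_neg, RCLike.norm_conj]
  have h2 : ‖pcr‖ ^ 2 = Real.log 2 / Real.pi := by
    have h3 := congrArg norm h
    rw [norm_mul, hs, norm_mul, norm_real, Real.norm_of_nonneg pcP_pos.le] at h3
    rw [sq, h3, pcP]
    simp
    have := Real.pi_ne_zero
    field_simp
  rw [← pcr_eq_pcR, ← h2, Real.sqrt_sq (norm_nonneg _)]

end PCRH

end

theorem theoremE1 :
    (∃ U : ℂ → Matrix (Fin 3) (Fin 3) ℂ, IsPCSolution U ∧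
      ∀ U' : ℂ → Matrix (Fin 3) (Fin 3) ℂ, IsPCSolution U' → Set.EqOn U' U pcDomain) ∧
    (∀ U : ℂ → Matrix (Fin 3) (Fin 3) ℂ, IsPCSolution U →
      ∃ r s : ℂ, HasPCExpansion U r s ∧
        ∀ r' s' : ℂ, HasPCExpansion U r' s' → r' = pcR ∧ r' = -(starRingEnd ℂ s')) ∧
    ‖pcR‖ = Real.sqrt (Real.log 2 / Real.pi) := by
  refine ⟨⟨PCRH.pcSol, PCRH.isPCSolution_pcSol, fun U' h => h.eqOn_pcSol⟩, fun U h => ?_,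
    PCRH.norm_pcR⟩
  have hU := PCRH.hasPCExpansion_congr PCRH.hasPCExpansion_pcSol h.eqOn_pcSol
  refine ⟨PCRH.pcr, PCRH.pcs, hU, fun r' s' h' => ?_⟩
  obtain ⟨rfl, rfl⟩ := hU.unique h'
  exact ⟨PCRH.pcr_eq_pcR, PCRH.pcr_eq_neg_conj_pcs⟩
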